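/- Fix $d\ge 2$, let $|\Psi_d^+\rangle=\frac1{\sqrt d}\sum_{i=0}^{d-1}|i\rangle|i\rangle\in\mathbb C^d\otimes\mathbb C^d$, and set $$\tilde p^\phi=\frac{3d-1}{d^2-1}\Bigl(1-\frac1d\Bigr)^d,\qquad \beta_d=\frac{d^2}{(d^2-1)\tilde p^\phi+1}.$$ **Steering.** Let $\mathbf F=\{F_{a|x}\}_{a,x}$ be a finite family of positive semidefinite $d\times d$ matrices ($x$ ranges over settings, $a$ over outcomes), not all zero. An assemblage $\boldsymbol\sigma=\{\sigma_{a|x}\}$ is *LHS* (admits a local-hidden-state model) if $\sigma_{a|x}=\int P(a|x,\lambda)\,\sigma_\lambda\,d\mu(\lambda)$ for a probability measure $\mu$, conditional distributions $P(\cdot|x,\lambda)$ and density matrices $\sigma_\lambda$ on $\mathbb C^d$, both depending measurably on $\lambda$. Let $\omega_s(\mathbf F)=\sup_{\boldsymbol\sigma\in\mathrm{LHS}}\sum_{a,x}\operatorname{tr}(F_{a|x}\sigma_{a|x})$ and $$LV_s(|\Psi_d^+\rangle,\mathbf F)=\sup_{\{E_{a|x}\}}\frac1{\omega_s(\mathbf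 F)}\sum_{a,x}\operatorname{tr}(F_{a|x}\sigma_{a|x}),\qquad \sigma_{a|x}=\operatorname{tr}_A\bigl[|\Psi_d^+\rangle\langle\Psi_d^+|(E_{a|x}\otimes\mathbb I)\bigr],$$ where the supremum is over all families of POVMs $\{E_{a|x}\}_a$ on $\mathbb C^d$, one for each setting $x$. Then $\omega_s(\mathbf F)$ is finite and positive, $LV_s(|\Psi_d^+\rangle,\mathbf F)$ is finite, and $$LV_s(|\Psi_d^+\rangle,\mathbf F)\le\beta_d .$$ **Bell nonlocality.** Let $\mathbf B=\{B_{ab|xy}\}$ be a finite family of non-negative reals, not all zero. Let $\omega(\mathbf B)=\sup_{\mathbf P}\sum_{a,b,x,y}B_{ab|xy}P(a,b|x,y)$ over all $\mathbf P$ of the form $P(a,b|x,y)=\int P(a|x,\lambda)P(b|y,\lambda)\,d\mu(\lambda)$ with $\mu$ a probability measure and $P(\cdot|x,\lambda)$, $P(\cdot|y,\lambda)$ conditional distributions depending measurably on $\lambda$, and let $$LV(|\Psi_d^+\rangle,\mathbf B)=\sup\frac1{\omega(\mathbf B)}\sum_{a,b,x,y}B_{ab|xy}\,\langle\Psi_d^+|E_{a|x}\otimes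 E_{b|y}|\Psi_d^+\rangle ,$$ where the supremum is over all families of local POVMs $\{E_{a|x}\}_a$ and $\{E_{b|y}\}_b$ on $\mathbb C^d$. Then $\omega(\mathbf B)$ is finite and positive, $LV(|\Psi_d^+\rangle,\mathbf B)$ is finite, and $LV(|\Psi_d^+\rangle,\mathbf B)\le\beta_d$. **Scaling.** $\beta_d\sim \dfrac{e\,d}{3}$ as $d\to\infty$, that is, $\beta_d\big/\tfrac{ed}{3}\to1$. -/

import Mathlib

open MeasureTheory Filter Asymptotics
open scoped ComplexOrder Kronecker Matrix Topology

noncomputable section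

namespace QSteering

/-- Operators on the single-party space `ℂ^d`. -/
abbrev Op (d : ℕ) : Type := Matrix (Fin d) (Fin d) ℂ

/-- Operators on `ℂ^d ⊗ ℂ^d`; the first index is Alice's, the second one is Bob's. -/
abbrev BipOp (d : ℕ) : Type := Matrix (Fin d × Fin d) (Fin d × Fin d) ℂ

/-- Density matrices on `ℂ^d`. -/
def IsDensity {d : ℕ} (ρ : Op d) : Prop := ρ.PosSemidef ∧ ρ.trace = 1

/-- `E x a` is the effect of outcome `a` of setting `x`; for each setting `x` the effects
form a (general) POVM. -/
def IsPOVMFamily {d : ℕ} {X A : Type*} [Fintype A] (E : X → A → Op d) : Prop :=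
  (∀ x a, (E x a).PosSemidef) ∧ ∀ x, ∑ a, E x a = 1

/-- A measurable family `p x a l` of conditional distributions `P(a | x, l)`. -/
def IsResponse {X A L : Type*} [Fintype A] [MeasurableSpace L] (p : X → A → L → ℝ) : Prop :=
  (∀ x a, Measurable (p x a)) ∧ (∀ x a l, 0 ≤ p x a l) ∧ ∀ x l, ∑ a, p x a l = 1

/-! ### The state -/

/-- The vector `|Ψ_d^+⟩ = d^{-1/2} ∑ i, |i⟩|i⟩`. -/
def maxEntKet (d : ℕ) : Fin d × Fin d → ℂ :=
  fun k => if k.1 = k.2 then ((1 / Real.sqrt d : ℝ) : ℂ) else 0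

/-- The density matrix `|Ψ_d^+⟩⟨Ψ_d^+|`. -/
def maxEnt (d : ℕ) : BipOp d := Matrix.vecMulVec (maxEntKet d) (star (maxEntKet d))

/-- The partial trace over Alice's subsystem. -/
def partialTraceA {d : ℕ} (M : BipOp d) : Op d :=
  Matrix.of fun j j' => ∑ i, M (i, j) (i, j')

/-! ### Steering -/

/-- The assemblage `σ_{a|x} = tr_A [ρ (E_{a|x} ⊗ 1)]`. -/
def assemblage {d : ℕ} {X A : Type*} (ρ : BipOp d) (E : X → A → Op d) : X → A → Op d :=
  fun x a => partialTraceA (ρ * (E x a ⊗ₖ (1 : Op d)))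

/-- `σ` has a local-hidden-state model
`σ_{a|x} = ∫ P(a|x,l) s_l dμ(l)`, the integral being taken entrywise. -/
def IsLHS {d : ℕ} {X A : Type*} [Fintype A] (σ : X → A → Op d) : Prop :=
  ∃ (L : Type) (_ : MeasurableSpace L) (μ : Measure L) (p : X → A → L → ℝ) (s : L → Op d),
    IsProbabilityMeasure μ ∧ IsResponse p ∧
    (∀ i j, Measurable fun l => s l i j) ∧ (∀ l, IsDensity (s l)) ∧
    ∀ x a i j, σ x a i j = ∫ l, (p x a l : ℂ) * s l i j ∂μ

/-- The steering functional `∑_{a,x} tr (F_{a|x} σ_{a|x})` (real for Hermitian `F`, `σ`). -/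
def steeringValue {d : ℕ} {X A : Type*} [Fintype X] [Fintype A] (F σ : X → A → Op d) : ℝ :=
  ∑ x, ∑ a, ((F x a * σ x a).trace).re

/-- The values of the steering functional on unsteerable assemblages. -/
def lhsValues {d : ℕ} {X A : Type*} [Fintype X] [Fintype A] (F : X → A → Op d) : Set ℝ :=
  {v | ∃ σ : X → A → Op d, IsLHS σ ∧ v = steeringValue F σ}

/-- The steering bound `ω_s(F)`. -/
def steeringBound {d : ℕ} {X A : Type*} [Fintype X] [Fintype A] (F : X → A → Op d) : ℝ :=
  sSup (lhsValues F)

/-- The steering fraction `Γ_s(σ, F)`. -/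
def steeringFraction {d : ℕ} {X A : Type*} [Fintype X] [Fintype A] (σ F : X → A → Op d) : ℝ :=
  1 / steeringBound F * steeringValue F σ

/-- The values of `Γ_s({ρ, E_A}, F)` over all families `E_A` of POVMs of Alice. -/
def steeringFractions {d : ℕ} {X A : Type*} [Fintype X] [Fintype A]
    (ρ : BipOp d) (F : X → A → Op d) : Set ℝ :=
  {v | ∃ E : X → A → Op d, IsPOVMFamily E ∧ v = steeringFraction (assemblage ρ E) F}

/-- The largest steering-inequality violation `LV_s(ρ, F)` under general POVMs. -/
def LVs {d : ℕ} {X A : Type*} [Fintype X] [Fintype A] (ρ : BipOp d) (F : X → A → Op d) : ℝ :=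
  sSup (steeringFractions ρ F)

/-! ### Bell nonlocality; `P a b x y` stands for `P(a,b|x,y)` and `B a b x y` for `B_{ab|xy}` -/

/-- `P` has a local-hidden-variable model. -/
def IsLHV {A B X Y : Type*} [Fintype A] [Fintype B] (P : A → B → X → Y → ℝ) : Prop :=
  ∃ (L : Type) (_ : MeasurableSpace L) (μ : Measure L)
    (p : X → A → L → ℝ) (q : Y → B → L → ℝ),
    IsProbabilityMeasure μ ∧ IsResponse p ∧ IsResponse q ∧
    ∀ a b x y, P a b x y = ∫ l, p x a l * q y b l ∂μ

/-- The quantum correlation `P(a,b|x,y) = tr [ρ (E_{a|x} ⊗ E_{b|y})]`. -/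
def quantumCorrelation {d : ℕ} {A B X Y : Type*} (ρ : BipOp d)
    (E : X → A → Op d) (G : Y → B → Op d) : A → B → X → Y → ℝ :=
  fun a b x y => ((ρ * (E x a ⊗ₖ G y b)).trace).re

/-- The Bell functional `∑ B_{ab|xy} P(a,b|x,y)`. -/
def bellValue {A B X Y : Type*} [Fintype A] [Fintype B] [Fintype X] [Fintype Y]
    (C P : A → B → X → Y → ℝ) : ℝ :=
  ∑ a, ∑ b, ∑ x, ∑ y, C a b x y * P a b x y

/-- The values of the Bell functional on Bell-local correlations. -/
def lhvValues {A B X Y : Type*} [Fintype A] [Fintype B] [Fintype X] [Fintype Y]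
    (C : A → B → X → Y → ℝ) : Set ℝ :=
  {v | ∃ P : A → B → X → Y → ℝ, IsLHV P ∧ v = bellValue C P}

/-- The local bound `ω(B)`. -/
def localBound {A B X Y : Type*} [Fintype A] [Fintype B] [Fintype X] [Fintype Y]
    (C : A → B → X → Y → ℝ) : ℝ :=
  sSup (lhvValues C)

/-- The nonlocality fraction `Γ(P, B)`. -/
def nonlocalityFraction {A B X Y : Type*} [Fintype A] [Fintype B] [Fintype X] [Fintype Y]
    (P C : A → B → X → Y → ℝ) : ℝ :=
  1 / localBound C * bellValue C P

/-- The values of `Γ({ρ, E}, B)` over all families of local POVMs of Alice and Bob. -/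
def nonlocalityFractions {d : ℕ} {A B X Y : Type*}
    [Fintype A] [Fintype B] [Fintype X] [Fintype Y]
    (ρ : BipOp d) (C : A → B → X → Y → ℝ) : Set ℝ :=
  {v | ∃ (E : X → A → Op d) (G : Y → B → Op d), IsPOVMFamily E ∧ IsPOVMFamily G ∧
    v = nonlocalityFraction (quantumCorrelation ρ E G) C}

/-- The largest Bell-inequality violation `LV(ρ, B)` under general POVMs. -/
def LV {d : ℕ} {A B X Y : Type*} [Fintype A] [Fintype B] [Fintype X] [Fintype Y]
    (ρ : BipOp d) (C : A → B → X → Y → ℝ) : ℝ :=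
  sSup (nonlocalityFractions ρ C)

/-! ### The bound -/

/-- `(3d-1)/(d^2-1) * (1-1/d)^d`. -/
def pTilde (d : ℕ) : ℝ := (3 * (d : ℝ) - 1) / ((d : ℝ) ^ 2 - 1) * (1 - 1 / (d : ℝ)) ^ d

/-- `d^2 / ((d^2-1) pTilde + 1)`. -/
def violationBound (d : ℕ) : ℝ := (d : ℝ) ^ 2 / (((d : ℝ) ^ 2 - 1) * pTilde d + 1)

end QSteering

end

/-! Let `p = pTilde d`. The isotropic state `p |Ψ⁺⟩⟨Ψ⁺| + (1 - p) 1/d²` is unsteerable under all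
POVMs, and mixing in white noise lowers the value of a positive functional by a controlled factor
only. On `Ψ⁺` a term has value `τ/d` with `τ = tr (F Eᵀ)`; on the isotropic state it has value `p
τ/d + (1 - p) tr F tr E / d²`. Since `tr F tr E ≥ τ/d`, the latter is at least `(p + (1 - p)/d²)
τ/d`, and that factor is `1 / violationBound d`. The isotropic value is at most the steering bound,
which gives the estimate (`steeringValue_maxEnt_le`).

The local model (`isLHS_isotropicAssemblage`) sends Bob a uniformly random pure state, realised by a
normalised Gaussian vector `z`. Alice splits her transposed effects into rank-one pieces `v v*` and
accepts a piece with probability `|⟨v|z⟩|²/|z|²` if this is at least `|v|²/d`, and never otherwise;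
on rejection she outputs `a` with probability `tr E_a / d`. By unitary covariance, an accepted piece
leaves Bob with `α v v* + γ |v|² 1`. The constant `γ` cancels in the full model, while `α = p/d`
follows from the Beta tail `P(|z₀|²/|z|² ≥ s) = (1 - s)^(d-1)`.

For Bell functionals, Bob's POVMs turn `B` into a positive steering functional and turn the
local-hidden-state model into a local-hidden-variable model, so the same comparison applies. -/

noncomputable section

namespace QSteering

/-! ### The standard complex Gaussian measure -/

/-- The squared Euclidean norm on `ℂ^d`. -/
def sqNorm {d : ℕ} (z : Fin d → ℂ) : ℝ := ∑ i, Complex.normSq (z i)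

/-- The standard complex Gaussian density on `ℂ^d`. -/
def gaussDensity (d : ℕ) (z : Fin d → ℂ) : ℝ := ∏ i, (Real.pi⁻¹ * Real.exp (-Complex.normSq (z i)))

/-- The standard complex Gaussian measure on `ℂ^d`. -/
def complexGaussian (d : ℕ) : Measure (Fin d → ℂ) :=
  volume.withDensity fun z => ENNReal.ofReal (gaussDensity d z)

lemma sqNorm_nonneg {d : ℕ} (z : Fin d → ℂ) : 0 ≤ sqNorm z :=
  Finset.sum_nonneg fun _ _ => Complex.normSq_nonneg _

lemma normSq_le_sqNorm {d : ℕ} (z : Fin d → ℂ) (i : Fin d) : Complex.normSq (z i) ≤ sqNorm z :=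
  Finset.single_le_sum (f := fun i => Complex.normSq (z i))
    (fun _ _ => Complex.normSq_nonneg _) (Finset.mem_univ i)

lemma sqNorm_eq_zero {d : ℕ} {z : Fin d → ℂ} : sqNorm z = 0 ↔ z = 0 := by
  rw [sqNorm, Finset.sum_eq_zero_iff_of_nonneg fun _ _ => Complex.normSq_nonneg _]
  simp [funext_iff]

@[fun_prop]
lemma measurable_sqNorm {d : ℕ} : Measurable (sqNorm : (Fin d → ℂ) → ℝ) := by
  unfold sqNorm
  exact Finset.measurable_sum _ fun i _ =>
    Complex.continuous_normSq.measurable.comp (measurable_pi_apply i)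

lemma sqNorm_eq_dotProduct {d : ℕ} (z : Fin d → ℂ) : (sqNorm z : ℂ) = star z ⬝ᵥ z := by
  simp [sqNorm, dotProduct, Complex.normSq_eq_conj_mul_self]

lemma gaussDensity_eq {d : ℕ} (z : Fin d → ℂ) :
    gaussDensity d z = Real.pi⁻¹ ^ d * Real.exp (-sqNorm z) := by
  simp [gaussDensity, sqNorm, Finset.prod_mul_distrib, ← Real.exp_sum, Finset.sum_neg_distrib]

lemma gaussDensity_nonneg {d : ℕ} (z : Fin d → ℂ) : 0 ≤ gaussDensity d z := by
  rw [gaussDensity_eq]; positivity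

lemma measurable_gaussDensity (d : ℕ) : Measurable (gaussDensity d) := by
  have : gaussDensity d = fun z => Real.pi⁻¹ ^ d * Real.exp (-sqNorm z) :=
    funext gaussDensity_eq
  rw [this]; fun_prop

/-- `∫ exp (-b |z|²) = π / b` on `ℂ`. -/
lemma integral_exp_neg_mul_normSq {b : ℝ} (hb : 0 < b) :
    ∫ z : ℂ, Real.exp (-b * Complex.normSq z) = Real.pi / b := by
  have h := Complex.integral_exp_neg_mul_rpow (p := 2) one_le_two hb
  have h2 : Real.Gamma (2 / 2 + 1) = 1 := by
    rw [div_self two_ne_zero, Real.Gamma_add_one one_ne_zero, Real.Gamma_one, mul_one]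
  rw [h2, neg_div, div_self two_ne_zero, Real.rpow_neg_one, mul_one] at h
  rw [div_eq_mul_inv, ← h]
  congr 1 with z
  rw [Real.rpow_two, Complex.normSq_eq_norm_sq]

/-- The integral of a non-integrable function is `0` by convention, whereas this one was computed to
be positive. -/
lemma integrable_exp_neg_mul_normSq {b : ℝ} (hb : 0 < b) :
    Integrable fun z : ℂ => Real.exp (-b * Complex.normSq z) := by
  by_contra h
  have h1 := integral_exp_neg_mul_normSq hb
  rw [integral_undef h] at h1
  have : 0 < Real.pi / b := div_pos Real.pi_pos hb
  linarith

lemma integrable_gaussDensity (d : ℕ) : Integrable (gaussDensity d) := by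
  refine Integrable.fintype_prod (f := fun _ z => Real.pi⁻¹ * Real.exp (-Complex.normSq z))
    fun _ => ?_
  have := (integrable_exp_neg_mul_normSq one_pos).const_mul Real.pi⁻¹
  simpa using this

lemma integral_gaussDensity (d : ℕ) : ∫ z, gaussDensity d z = 1 := by
  unfold gaussDensity
  rw [integral_fintype_prod_volume_eq_pow fun z : ℂ => Real.pi⁻¹ * Real.exp (-Complex.normSq z)]
  have := integral_exp_neg_mul_normSq one_pos
  simp only [neg_mul, one_mul, div_one] at this
  rw [integral_const_mul, this, inv_mul_cancel₀ Real.pi_ne_zero, one_pow]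

lemma lintegral_gaussDensity (d : ℕ) : ∫⁻ z, ENNReal.ofReal (gaussDensity d z) = 1 := by
  rw [← ofReal_integral_eq_lintegral_ofReal (integrable_gaussDensity d)
    (ae_of_all _ gaussDensity_nonneg), integral_gaussDensity, ENNReal.ofReal_one]

instance isProbabilityMeasure_complexGaussian (d : ℕ) :
    IsProbabilityMeasure (complexGaussian d) :=
  ⟨by rw [complexGaussian, withDensity_apply _ MeasurableSet.univ, setLIntegral_univ,
    lintegral_gaussDensity]⟩

lemma integral_complexGaussian {E : Type*} [NormedAddCommGroup E] [NormedSpace ℝ E] (d : ℕ)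
    (f : (Fin d → ℂ) → E) :
    ∫ z, f z ∂complexGaussian d = ∫ z, gaussDensity d z • f z := by
  rw [complexGaussian, integral_withDensity_eq_integral_toReal_smul
    (measurable_gaussDensity d).ennreal_ofReal (by simp)]
  simp [ENNReal.toReal_ofReal, gaussDensity_nonneg]

lemma ae_sqNorm_ne_zero (n : ℕ) : ∀ᵐ z ∂complexGaussian (n + 1), sqNorm z ≠ 0 := by
  refine (withDensity_absolutelyContinuous _ _).ae_le ?_
  have : (volume : Measure (Fin (n + 1) → ℂ)) {0} = 0 := measure_singleton 0
  refine measure_mono_null (fun z hz => ?_) this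
  simpa [sqNorm_eq_zero] using hz

/-! ### Unitary invariance -/

lemma sqNorm_mulVec {d : ℕ} {U : Op d} (hU : U ∈ Matrix.unitaryGroup (Fin d) ℂ)
    (z : Fin d → ℂ) : sqNorm (U *ᵥ z) = sqNorm z := by
  have h : ((sqNorm (U *ᵥ z) : ℝ) : ℂ) = (sqNorm z : ℝ) := by
    rw [sqNorm_eq_dotProduct, sqNorm_eq_dotProduct, Matrix.star_mulVec, Matrix.dotProduct_mulVec,
      Matrix.vecMul_vecMul, ← Matrix.star_eq_conjTranspose, Matrix.mem_unitaryGroup_iff'.1 hU,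
      Matrix.vecMul_one]
  exact_mod_cast h

/-- Multiplication by a unitary matrix as a continuous real-linear equivalence. -/
def unitaryEquiv {d : ℕ} (U : Matrix.unitaryGroup (Fin d) ℂ) : (Fin d → ℂ) ≃L[ℝ] (Fin d → ℂ) :=
  ((Matrix.UnitaryGroup.toLinearEquiv U).restrictScalars ℝ).toContinuousLinearEquiv

lemma unitaryEquiv_apply {d : ℕ} (U : Matrix.unitaryGroup (Fin d) ℂ) (z : Fin d → ℂ) :
    unitaryEquiv U z = (U : Op d) *ᵥ z := rfl

/-- By uniqueness of Haar measure the pushforward is a multiple of `volume`. Testing on the Gaussian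
density, which is unitarily invariant and has integral one, shows that the factor is `1`; no
determinant is needed. -/
lemma map_unitaryEquiv_volume {d : ℕ} (U : Matrix.unitaryGroup (Fin d) ℂ) :
    Measure.map (unitaryEquiv U) volume = volume := by
  have := ContinuousLinearEquiv.isAddHaarMeasure_map (unitaryEquiv U)
    (volume : Measure (Fin d → ℂ))
  have h := Measure.isAddLeftInvariant_eq_smul (Measure.map (unitaryEquiv U) volume)
    (volume : Measure (Fin d → ℂ))
  have h1 : ∫⁻ z, ENNReal.ofReal (gaussDensity d z) ∂(Measure.map (unitaryEquiv U) volume) = 1 := by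
    rw [lintegral_map (measurable_gaussDensity d).ennreal_ofReal
      (unitaryEquiv U).continuous.measurable]
    simp_rw [unitaryEquiv_apply, gaussDensity_eq, sqNorm_mulVec U.2, ← gaussDensity_eq]
    exact lintegral_gaussDensity d
  rw [h, lintegral_smul_measure, lintegral_gaussDensity] at h1
  have h2 : ((Measure.map (unitaryEquiv U) volume).addHaarScalarFactor volume) = 1 := by
    rw [ENNReal.smul_def, smul_eq_mul, mul_one] at h1
    exact_mod_cast h1
  rw [h2, one_smul] at h
  exact h

lemma integral_unitary {E : Type*} [NormedAddCommGroup E] [NormedSpace ℝ E] {d : ℕ} {U : Op d}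
    (hU : U ∈ Matrix.unitaryGroup (Fin d) ℂ) (f : (Fin d → ℂ) → E) :
    ∫ z, f (U *ᵥ z) ∂complexGaussian d = ∫ z, f z ∂complexGaussian d := by
  rw [integral_complexGaussian, integral_complexGaussian]
  have hp : MeasurePreserving (unitaryEquiv ⟨U, hU⟩) volume volume :=
    ⟨(unitaryEquiv ⟨U, hU⟩).continuous.measurable, map_unitaryEquiv_volume ⟨U, hU⟩⟩
  conv_rhs => rw [← hp.integral_comp (unitaryEquiv ⟨U, hU⟩).toHomeomorph.measurableEmbedding]
  simp_rw [unitaryEquiv_apply, gaussDensity_eq, sqNorm_mulVec hU]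

/-! ### The distribution of the first squared coordinate of a random unit vector -/

/-- Polar coordinates reduce this to the integral of `y exp (-y²)` over `y > √r`, with
antiderivative `-exp (-y²) / 2`. -/
lemma integral_normSq_tail {r : ℝ} (hr : 0 ≤ r) :
    ∫ z : ℂ, (if r ≤ Complex.normSq z then Real.exp (-Complex.normSq z) else 0)
      = Real.pi * Real.exp (-r) := by
  have h := integral_fun_norm_addHaar (volume : Measure ℂ)
    (fun y : ℝ => if r ≤ y ^ 2 then Real.exp (-y ^ 2) else 0)
  have hball : (volume : Measure ℂ).real (Metric.ball 0 1) = Real.pi := by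
    simp [Measure.real, Complex.volume_ball]
  have hint : ∫ y in Set.Ioi (0 : ℝ), y ^ (Module.finrank ℝ ℂ - 1) •
      (if r ≤ y ^ 2 then Real.exp (-y ^ 2) else 0) = Real.exp (-r) / 2 := by
    have h1 : ∀ y ∈ Set.Ioi (0 : ℝ), y ^ (Module.finrank ℝ ℂ - 1) •
        (if r ≤ y ^ 2 then Real.exp (-y ^ 2) else 0) =
        (Set.Ici (Real.sqrt r)).indicator (fun y => y * Real.exp (-y ^ 2)) y := by
      intro y hy
      simp only [Complex.finrank_real_complex, Nat.add_one_sub_one, pow_one, smul_eq_mul,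
        Set.indicator, Set.mem_Ici, Real.sqrt_le_left (le_of_lt hy)]
      split_ifs <;> simp
    rw [setIntegral_congr_fun measurableSet_Ioi h1, setIntegral_indicator measurableSet_Ici]
    have h2 : (Set.Ioi (0 : ℝ) ∩ Set.Ici (Real.sqrt r) : Set ℝ) =ᵐ[volume]
        (Set.Ioi (Real.sqrt r) : Set ℝ) := by
      have : (Set.Ioi (0 : ℝ) ∩ Set.Ioi (Real.sqrt r) : Set ℝ) = Set.Ioi (Real.sqrt r) :=
        Set.inter_eq_right.2 (Set.Ioi_subset_Ioi (Real.sqrt_nonneg r))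
      conv_rhs => rw [← this]
      exact (ae_eq_refl _).inter Ioi_ae_eq_Ici.symm
    rw [setIntegral_congr_set h2]
    have hd : ∀ x ∈ Set.Ici (Real.sqrt r),
        HasDerivAt (fun y : ℝ => -Real.exp (-y ^ 2) / 2) (x * Real.exp (-x ^ 2)) x := by
      intro x _
      have := (((hasDerivAt_pow 2 x).neg.exp).neg).div_const 2
      convert! this using 1
      simp; ring
    have ht : Tendsto (fun y : ℝ => -Real.exp (-y ^ 2) / 2) atTop (𝓝 0) := by
      have h3 : Tendsto (fun y : ℝ => Real.exp (-y ^ 2)) atTop (𝓝 0) :=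
        Real.tendsto_exp_atBot.comp (tendsto_neg_atTop_atBot.comp (tendsto_pow_atTop two_ne_zero))
      simpa using (h3.neg).div_const 2
    rw [integral_Ioi_of_hasDerivAt_of_nonneg' hd
      (fun x hx => mul_nonneg ((Real.sqrt_nonneg r).trans (le_of_lt hx)) (Real.exp_pos _).le) ht,
      Real.sq_sqrt hr]
    ring
  rw [hint, hball] at h
  simp only [Complex.finrank_real_complex, smul_eq_mul, nsmul_eq_mul] at h
  simp_rw [Complex.normSq_eq_norm_sq]
  rw [h]
  push_cast; ring

/-- A uniformly random unit vector of `ℂ^(n+1)` satisfies `P(|z_0|² ≥ s) = (1-s)^n`. -/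
lemma integral_tail_complexGaussian (n : ℕ) {s : ℝ} (hs0 : 0 < s) (hs1 : s < 1) :
    ∫ z, (if s * sqNorm z ≤ Complex.normSq (z 0) then (1 : ℝ) else 0) ∂complexGaussian (n + 1)
      = (1 - s) ^ n := by
  have h1s : 0 < 1 - s := by linarith
  -- Writing `z = (w, y)`, the event `s (|w|² + |y|²) ≤ |w|²` is `c |y|² ≤ |w|²`.
  set c := s / (1 - s) with hc
  have hc0 : 0 < c := div_pos hs0 h1s
  rw [integral_complexGaussian,
    ← (volume_preserving_piFinSuccAbove (fun _ => ℂ) (0 : Fin (n + 1))).symm.integral_comp']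
  have key : ∀ (w : ℂ) (y : Fin n → ℂ),
      gaussDensity (n + 1) (Fin.cons w y : Fin (n + 1) → ℂ) •
        (if s * sqNorm (Fin.cons w y : Fin (n + 1) → ℂ) ≤
          Complex.normSq ((Fin.cons w y : Fin (n + 1) → ℂ) 0) then (1 : ℝ) else 0) =
      gaussDensity n y * (Real.pi⁻¹ *
        (if c * sqNorm y ≤ Complex.normSq w then Real.exp (-Complex.normSq w) else 0)) := by
    intro w y
    have hcond : s * sqNorm (Fin.cons w y : Fin (n + 1) → ℂ) ≤
        Complex.normSq ((Fin.cons w y : Fin (n + 1) → ℂ) 0) ↔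
        c * sqNorm y ≤ Complex.normSq w := by
      rw [hc, div_mul_eq_mul_div, div_le_iff₀ h1s]
      simp only [sqNorm, Fin.sum_univ_succ, Fin.cons_zero, Fin.cons_succ]
      constructor <;> intro h <;> nlinarith
    simp only [hcond]
    simp only [gaussDensity, Fin.prod_univ_succ, Fin.cons_zero, Fin.cons_succ]
    split_ifs <;> simp; ring
  have hconv : ∀ p : ℂ × (Fin n → ℂ),
      (MeasurableEquiv.piFinSuccAbove (fun _ => ℂ) (0 : Fin (n + 1))).symm p =
        (Fin.cons p.1 p.2 : Fin (n + 1) → ℂ) := by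
    intro p
    simp [MeasurableEquiv.piFinSuccAbove, Fin.insertNthEquiv]
  simp_rw [hconv, key]
  have hmeas : Measurable fun p : ℂ × (Fin n → ℂ) => gaussDensity n p.2 * (Real.pi⁻¹ *
      (if c * sqNorm p.2 ≤ Complex.normSq p.1 then Real.exp (-Complex.normSq p.1) else 0)) := by
    have hn : Measurable Complex.normSq := Complex.continuous_normSq.measurable
    refine ((measurable_gaussDensity n).comp measurable_snd).mul (measurable_const.mul ?_)
    exact Measurable.ite (measurableSet_le (by fun_prop) (by fun_prop)) (by fun_prop)
      measurable_const
  have hintg : Integrable (fun p : ℂ × (Fin n → ℂ) => gaussDensity n p.2 * (Real.pi⁻¹ *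
      (if c * sqNorm p.2 ≤ Complex.normSq p.1 then Real.exp (-Complex.normSq p.1) else 0)))
      (volume.prod volume) := by
    have hdom := (integrable_exp_neg_mul_normSq one_pos).mul_prod (integrable_gaussDensity n)
    refine (hdom.const_mul Real.pi⁻¹).mono' hmeas.aestronglyMeasurable (ae_of_all _ fun p => ?_)
    rw [Real.norm_of_nonneg (mul_nonneg (gaussDensity_nonneg _) (by positivity))]
    have : (if c * sqNorm p.2 ≤ Complex.normSq p.1 then Real.exp (-Complex.normSq p.1) else 0) ≤
        Real.exp (-1 * Complex.normSq p.1) := by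
      split_ifs
      · simp
      · positivity
    calc _ ≤ gaussDensity n p.2 * (Real.pi⁻¹ * Real.exp (-1 * Complex.normSq p.1)) :=
          mul_le_mul_of_nonneg_left (mul_le_mul_of_nonneg_left this (by positivity))
            (gaussDensity_nonneg _)
      _ = _ := by ring
  rw [Measure.volume_eq_prod, integral_prod_symm _ hintg]
  simp_rw [integral_const_mul]
  -- The integral over `w` contributes `exp (-c |y|²)`. What remains is a product of `n` Gaussians
  -- of rate `1 + c = 1 / (1 - s)`, each integrating to `1 - s`.
  have hprod : ∀ y : Fin n → ℂ, gaussDensity n y * (Real.pi⁻¹ *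
      ∫ w : ℂ, (if c * sqNorm y ≤ Complex.normSq w then Real.exp (-Complex.normSq w) else 0)) =
      ∏ i, (Real.pi⁻¹ * Real.exp (-(1 + c) * Complex.normSq (y i))) := by
    intro y
    rw [integral_normSq_tail (mul_nonneg hc0.le (sqNorm_nonneg y)),
      inv_mul_cancel_left₀ Real.pi_ne_zero, gaussDensity_eq, Finset.prod_mul_distrib,
      ← Real.exp_sum, ← Finset.mul_sum, mul_assoc, ← Real.exp_add]
    simp only [Finset.prod_const, Finset.card_univ, Fintype.card_fin, sqNorm]
    congr 2; ring
  simp_rw [hprod]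
  rw [integral_fintype_prod_volume_eq_pow
    fun w : ℂ => Real.pi⁻¹ * Real.exp (-(1 + c) * Complex.normSq w), integral_const_mul,
    integral_exp_neg_mul_normSq (by linarith), Fintype.card_fin]
  congr 1
  have : 1 + c = (1 - s)⁻¹ := by rw [hc]; field_simp; ring
  rw [this]
  field_simp

/-! ### Random pure states -/

/-- The pure state `|z⟩⟨z| / |z|²` (and the maximally mixed state for `z = 0`). -/
def pureState {d : ℕ} (z : Fin d → ℂ) : Op d :=
  if sqNorm z = 0 then ((d : ℂ)⁻¹) • 1 else ((sqNorm z : ℂ)⁻¹) • Matrix.vecMulVec z (star z)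

lemma pureState_apply {d : ℕ} (z : Fin d → ℂ) (i j : Fin d) : pureState z i j =
    if sqNorm z = 0 then (d : ℂ)⁻¹ * (1 : Op d) i j else (sqNorm z : ℂ)⁻¹ * (z i * star (z j)) := by
  unfold pureState
  split_ifs <;> simp [Matrix.vecMulVec_apply]

lemma isDensity_pureState {d : ℕ} [NeZero d] (z : Fin d → ℂ) : IsDensity (pureState z) := by
  unfold pureState
  split_ifs with h
  · refine ⟨Matrix.PosSemidef.one.smul (by positivity), ?_⟩
    simp [Matrix.trace_smul, NeZero.ne d]
  · refine ⟨(Matrix.posSemidef_vecMulVec_self_star z).smul ?_, ?_⟩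
    · rw [← Complex.ofReal_inv]
      exact_mod_cast inv_nonneg.2 (sqNorm_nonneg z)
    · rw [Matrix.trace_smul, Matrix.trace_vecMulVec, dotProduct_comm, ← sqNorm_eq_dotProduct,
        smul_eq_mul, inv_mul_cancel₀ (by exact_mod_cast h)]

lemma measurable_pureState {d : ℕ} (i j : Fin d) :
    Measurable fun z : Fin d → ℂ => pureState z i j := by
  simp_rw [pureState_apply]
  refine Measurable.ite (measurable_sqNorm (measurableSet_singleton 0)) measurable_const ?_
  exact (Complex.measurable_ofReal.comp measurable_sqNorm).inv.mul
    ((measurable_pi_apply i).mul (continuous_star.measurable.comp (measurable_pi_apply j)))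

lemma pureState_mulVec {d : ℕ} {U : Op d} (hU : U ∈ Matrix.unitaryGroup (Fin d) ℂ)
    (z : Fin d → ℂ) : pureState (U *ᵥ z) = U * pureState z * Uᴴ := by
  unfold pureState
  rw [sqNorm_mulVec hU]
  split_ifs
  · rw [mul_smul_comm, smul_mul_assoc, mul_one, ← Matrix.star_eq_conjTranspose,
      Matrix.mem_unitaryGroup_iff.1 hU]
  · rw [mul_smul_comm, smul_mul_assoc, Matrix.mul_vecMulVec, Matrix.vecMulVec_mul,
      Matrix.star_mulVec]

/-- Entries of density matrices have modulus at most one. -/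
lemma IsDensity.norm_apply_le {d : ℕ} {ρ : Op d} (h : IsDensity ρ) (i j : Fin d) :
    ‖ρ i j‖ ≤ 1 := by
  obtain ⟨m, v, hv⟩ := Matrix.posSemidef_iff_eq_sum_vecMulVec.1 h.1
  have htr : ∑ k, sqNorm (v k) = 1 := by
    have h1 : ((∑ k, sqNorm (v k) : ℝ) : ℂ) = 1 := by
      rw [← h.2, hv, Matrix.trace_sum, Complex.ofReal_sum]
      refine Finset.sum_congr rfl fun k _ => ?_
      rw [Matrix.trace_vecMulVec, dotProduct_comm, sqNorm_eq_dotProduct]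
    exact_mod_cast h1
  rw [hv, ← htr, Matrix.sum_apply]
  -- For each rank-one piece, `|v_i| |v_j| ≤ (|v_i|² + |v_j|²) / 2 ≤ |v|²`, and these squared norms
  -- add up to the trace.
  refine (norm_sum_le _ _).trans (Finset.sum_le_sum fun k _ => ?_)
  rw [Matrix.vecMulVec_apply, norm_mul, Pi.star_apply, norm_star]
  have hi := normSq_le_sqNorm (v k) i
  have hj := normSq_le_sqNorm (v k) j
  rw [Complex.normSq_eq_norm_sq] at hi hj
  nlinarith [sq_nonneg (‖v k i‖ - ‖v k j‖)]

lemma integrable_mul_density {d : ℕ} {L : Type*} [MeasurableSpace L] {μ : Measure L}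
    [IsFiniteMeasure μ] {f : L → ℝ} {s : L → Op d} (hf : Measurable f) {c : ℝ}
    (hc : ∀ l, |f l| ≤ c) (hs : ∀ i j, Measurable fun l => s l i j) (hd : ∀ l, IsDensity (s l))
    (i j : Fin d) : Integrable (fun l => (f l : ℂ) * s l i j) μ := by
  refine (integrable_const c).mono'
    ((Complex.measurable_ofReal.comp hf).mul (hs i j)).aestronglyMeasurable (ae_of_all _ fun l => ?_)
  rw [norm_mul, Complex.norm_real, Real.norm_eq_abs]
  calc |f l| * ‖s l i j‖ ≤ c * 1 :=
        mul_le_mul (hc l) ((hd l).norm_apply_le i j) (norm_nonneg _) ((abs_nonneg _).trans (hc l))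
    _ = c := mul_one c

/-- The average of the random pure state with weight `f`. -/
def stateAverage {d : ℕ} (f : (Fin d → ℂ) → ℝ) : Op d :=
  Matrix.of fun i j => ∫ z, (f z : ℂ) * pureState z i j ∂complexGaussian d

lemma stateAverage_apply {d : ℕ} (f : (Fin d → ℂ) → ℝ) (i j : Fin d) :
    stateAverage f i j = ∫ z, (f z : ℂ) * pureState z i j ∂complexGaussian d := rfl

lemma integrable_mul_pureState {d : ℕ} [NeZero d] {f : (Fin d → ℂ) → ℝ} (hf : Measurable f) {c : ℝ}
    (hc : ∀ z, |f z| ≤ c) (i j : Fin d) :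
    Integrable (fun z => (f z : ℂ) * pureState z i j) (complexGaussian d) :=
  integrable_mul_density hf hc measurable_pureState isDensity_pureState i j

/-- Unitary covariance of weighted averages. -/
lemma stateAverage_unitary {d : ℕ} [NeZero d] {f g : (Fin d → ℂ) → ℝ} {U : Op d}
    (hU : U ∈ Matrix.unitaryGroup (Fin d) ℂ) (hg : Measurable g) {c : ℝ} (hc : ∀ z, |g z| ≤ c)
    (hfg : ∀ z, f (U *ᵥ z) = g z) : stateAverage f = U * stateAverage g * Uᴴ := by
  ext i j
  have hint : ∀ l k, Integrable (fun z => (g z : ℂ) * (U i l * pureState z l k * Uᴴ k j))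
      (complexGaussian d) := fun l k =>
    ((integrable_mul_pureState hg hc l k).const_mul (U i l * Uᴴ k j)).congr
      (ae_of_all _ fun z => by simp only; ring)
  rw [stateAverage_apply, ← integral_unitary hU]
  simp_rw [hfg, pureState_mulVec hU, Matrix.mul_apply, Finset.sum_mul, Finset.mul_sum,
    stateAverage_apply]
  rw [integral_finsetSum _ fun k _ => integrable_finsetSum _ fun l _ => hint l k]
  refine Finset.sum_congr rfl fun k _ => ?_
  rw [integral_finsetSum _ fun l _ => hint l k]
  refine Finset.sum_congr rfl fun l _ => ?_
  rw [← integral_const_mul, ← integral_mul_const]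
  congr 1 with z
  ring

/-- The diagonal unitary flipping the sign of the `k`-th coordinate. -/
def signFlip {d : ℕ} (k : Fin d) : Op d := Matrix.diagonal (Function.update 1 k (-1))

lemma signFlip_mem {d : ℕ} (k : Fin d) : signFlip k ∈ Matrix.unitaryGroup (Fin d) ℂ := by
  rw [Matrix.mem_unitaryGroup_iff, Matrix.star_eq_conjTranspose, signFlip,
    Matrix.diagonal_conjTranspose, Matrix.diagonal_mul_diagonal, ← Matrix.diagonal_one]
  congr 1 with i
  by_cases h : i = k
  · subst h; simp
  · simp [h]

lemma signFlip_mulVec {d : ℕ} (k i : Fin d) (z : Fin d → ℂ) :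
    (signFlip k *ᵥ z) i = if i = k then -z i else z i := by
  rw [signFlip, Matrix.mulVec_diagonal]
  split_ifs with h
  · subst h; simp
  · simp [h]

lemma permMatrix_mem {d : ℕ} (σ : Equiv.Perm (Fin d)) :
    σ.permMatrix ℂ ∈ Matrix.unitaryGroup (Fin d) ℂ := by
  rw [Matrix.mem_unitaryGroup_iff, Matrix.star_eq_conjTranspose, Matrix.conjTranspose_permMatrix,
    ← Matrix.permMatrix_mul, inv_mul_cancel, Matrix.permMatrix_one]

/-- Conjugation by the sign flip of coordinate `i` fixes the average but negates its `(i, j)` entry.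
-/
lemma stateAverage_offDiag {d : ℕ} [NeZero d] {f : (Fin d → ℂ) → ℝ} (hf : Measurable f) {c : ℝ}
    (hc : ∀ z, |f z| ≤ c) (hsign : ∀ k z, f (signFlip k *ᵥ z) = f z) {i j : Fin d} (hij : i ≠ j) :
    stateAverage f i j = 0 := by
  have h := congrFun (congrFun (stateAverage_unitary (signFlip_mem i) hf hc (hsign i)) i) j
  rw [signFlip, Matrix.diagonal_conjTranspose, Matrix.mul_diagonal, Matrix.diagonal_mul] at h
  simp [hij.symm] at h
  linear_combination (1 / 2 : ℂ) * h

lemma stateAverage_diag_eq {d : ℕ} [NeZero d] {f : (Fin d → ℂ) → ℝ} (hf : Measurable f) {c : ℝ}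
    (hc : ∀ z, |f z| ≤ c) {i j : Fin d} (hswap : ∀ z, f (z ∘ Equiv.swap i j) = f z) :
    stateAverage f i i = stateAverage f j j := by
  have h := congrFun (congrFun (stateAverage_unitary (f := f) (permMatrix_mem (Equiv.swap i j)) hf hc
    (fun z => by rw [Matrix.permMatrix_mulVec]; exact hswap z)) i) i
  rw [Matrix.conjTranspose_permMatrix, Equiv.swap_inv] at h
  rw [h]
  simp [Equiv.Perm.permMatrix, PEquiv.toMatrix_toPEquiv_mul, PEquiv.mul_toMatrix_toPEquiv]

lemma trace_stateAverage {d : ℕ} [NeZero d] {f : (Fin d → ℂ) → ℝ} (hf : Measurable f) {c : ℝ}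
    (hc : ∀ z, |f z| ≤ c) :
    ∑ i, stateAverage f i i = ((∫ z, f z ∂complexGaussian d : ℝ) : ℂ) := by
  simp_rw [stateAverage_apply]
  rw [← integral_finsetSum _ fun i _ => integrable_mul_pureState hf hc i i, ← integral_complex_ofReal]
  congr 1 with z
  rw [← Finset.mul_sum]
  have := (isDensity_pureState z).2
  rw [Matrix.trace] at this
  simp only [Matrix.diag_apply] at this
  rw [this, mul_one]

/-- The average of the uniformly random pure state is maximally mixed. -/
lemma stateAverage_one {d : ℕ} [NeZero d] :
    stateAverage (fun _ : Fin d → ℂ => (1 : ℝ)) = (d : ℂ)⁻¹ • 1 := by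
  have hm : Measurable fun _ : Fin d → ℂ => (1 : ℝ) := measurable_const
  have hc : ∀ z : Fin d → ℂ, |(fun _ : Fin d → ℂ => (1 : ℝ)) z| ≤ 1 := by simp
  have htr := trace_stateAverage hm hc
  have hd : ∀ i, stateAverage (fun _ : Fin d → ℂ => (1 : ℝ)) i i =
      stateAverage (fun _ : Fin d → ℂ => (1 : ℝ)) 0 0 := fun i =>
    stateAverage_diag_eq hm hc fun _ => rfl
  rw [Finset.sum_congr rfl fun i _ => hd i] at htr
  simp only [Finset.sum_const, Finset.card_univ, Fintype.card_fin, nsmul_eq_mul, integral_const,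
    probReal_univ, smul_eq_mul, mul_one, Complex.ofReal_one] at htr
  ext i j
  by_cases hij : i = j
  · subst hij
    rw [hd i, Matrix.smul_apply, Matrix.one_apply_eq, smul_eq_mul, mul_one]
    exact eq_inv_of_mul_eq_one_right htr
  · rw [stateAverage_offDiag hm hc (fun _ _ => rfl) hij]
    simp [Matrix.one_apply_ne hij]

/-! ### The truncated overlap -/

/-- The overlap `|⟨u|z⟩|² / |z|²` if it is at least `|u|² / d`, and zero otherwise. -/
def truncOverlap {d : ℕ} (u z : Fin d → ℂ) : ℝ :=
  if sqNorm u * sqNorm z ≤ d * Complex.normSq (star u ⬝ᵥ z) then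
    Complex.normSq (star u ⬝ᵥ z) / sqNorm z else 0

lemma truncOverlap_nonneg {d : ℕ} (u z : Fin d → ℂ) : 0 ≤ truncOverlap u z := by
  unfold truncOverlap
  split_ifs
  · exact div_nonneg (Complex.normSq_nonneg _) (sqNorm_nonneg z)
  · exact le_rfl

lemma truncOverlap_le {d : ℕ} (u z : Fin d → ℂ) :
    truncOverlap u z ≤ Complex.normSq (star u ⬝ᵥ z) / sqNorm z := by
  unfold truncOverlap
  split_ifs
  · exact le_rfl
  · exact div_nonneg (Complex.normSq_nonneg _) (sqNorm_nonneg z)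

lemma measurable_truncOverlap {d : ℕ} (u : Fin d → ℂ) : Measurable (truncOverlap u) := by
  have h : Measurable fun z : Fin d → ℂ => Complex.normSq (star u ⬝ᵥ z) := by
    refine Complex.continuous_normSq.measurable.comp ?_
    unfold dotProduct
    exact Finset.measurable_sum _ fun i _ => measurable_const.mul (measurable_pi_apply i)
  exact Measurable.ite (measurableSet_le (by fun_prop) (by fun_prop)) (h.div measurable_sqNorm)
    measurable_const

/-- Reduces statements about all `u` to the first basis vector: `u / |u|` is completed to an
orthonormal basis, whose matrix is `U`. -/
lemma exists_unitary_col {d : ℕ} [NeZero d] (u : Fin d → ℂ) :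
    ∃ U ∈ Matrix.unitaryGroup (Fin d) ℂ,
      u = (Real.sqrt (sqNorm u) : ℂ) • (U *ᵥ Pi.single 0 1) := by
  by_cases hu : u = 0
  · refine ⟨1, one_mem _, ?_⟩
    simp [hu, sqNorm_eq_zero.2]
  · have hs : sqNorm u ≠ 0 := fun h => hu (sqNorm_eq_zero.1 h)
    have hr : Real.sqrt (sqNorm u) ≠ 0 := (Real.sqrt_pos.2 ((sqNorm_nonneg u).lt_of_ne' hs)).ne'
    have hnorm : ‖(WithLp.toLp 2 u : EuclideanSpace ℂ (Fin d))‖ = Real.sqrt (sqNorm u) := by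
      rw [EuclideanSpace.norm_eq]
      simp [sqNorm, Complex.normSq_eq_norm_sq]
    -- Only the value at index `0` matters: the basis extension is applied to the restriction of `v`
    -- to `{0}`.
    let v : Fin d → EuclideanSpace ℂ (Fin d) := fun _ =>
      ((Real.sqrt (sqNorm u) : ℂ)⁻¹) • WithLp.toLp 2 u
    have hv : Orthonormal ℂ (({0} : Set (Fin d)).domRestrict v) := by
      constructor
      · rintro ⟨i, hi⟩
        simp only [Set.domRestrict_apply, v]
        rw [norm_smul, hnorm, norm_inv, Complex.norm_real, Real.norm_of_nonneg (Real.sqrt_nonneg _),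
          inv_mul_cancel₀ hr]
      · rintro ⟨i, hi⟩ ⟨j, hj⟩ hij
        exact absurd (Subtype.ext (hi.trans hj.symm)) hij
    obtain ⟨b, hb⟩ := hv.exists_orthonormalBasis_extension_of_card_eq (by simp)
    refine ⟨(EuclideanSpace.basisFun (Fin d) ℂ).toBasis.toMatrix b,
      OrthonormalBasis.toMatrix_orthonormalBasis_mem_unitary _ _, ?_⟩
    ext i
    have hb0 := hb 0 rfl
    simp only [Pi.smul_apply, Matrix.mulVec_single_one, Matrix.col_apply, Module.Basis.toMatrix_apply,
      hb0, v]
    simp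
    field_simp

/-- The threshold `|u|² / d` scales with `u` in the same way as the overlap, so truncation preserves
homogeneity of degree two. -/
lemma truncOverlap_unitary {d : ℕ} [NeZero d] {U : Op d} (hU : U ∈ Matrix.unitaryGroup (Fin d) ℂ)
    (r : ℝ) (z : Fin d → ℂ) : truncOverlap ((r : ℂ) • (U *ᵥ Pi.single 0 1)) (U *ᵥ z) =
      r ^ 2 * truncOverlap (Pi.single 0 1) z := by
  have h1 : star ((r : ℂ) • (U *ᵥ Pi.single 0 1)) ⬝ᵥ (U *ᵥ z) = r * z 0 := by
    rw [star_smul, smul_dotProduct, Matrix.star_mulVec, ← Matrix.dotProduct_mulVec,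
      Matrix.mulVec_mulVec, ← Matrix.star_eq_conjTranspose, Matrix.mem_unitaryGroup_iff'.1 hU,
      Matrix.one_mulVec]
    simp
  have h2 : star (Pi.single 0 1 : Fin d → ℂ) ⬝ᵥ z = z 0 := by simp
  have h3 : ∀ w : Fin d → ℂ, sqNorm ((r : ℂ) • w) = r ^ 2 * sqNorm w := by
    intro w; simp [sqNorm, Finset.mul_sum, sq]
  have h4 : sqNorm (Pi.single 0 1 : Fin d → ℂ) = 1 := by
    rw [sqNorm, Finset.sum_eq_single 0]
    · simp
    · intro i _ hi; simp [hi]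
    · simp
  unfold truncOverlap
  rw [h1, h2, h3, sqNorm_mulVec hU, sqNorm_mulVec hU, h4, map_mul, Complex.normSq_ofReal, ← sq]
  by_cases hr : r = 0
  · simp [hr]
  · have hr2 : 0 < r ^ 2 := by positivity
    have : r ^ 2 * 1 * sqNorm z ≤ d * (r ^ 2 * Complex.normSq (z 0)) ↔
        1 * sqNorm z ≤ d * Complex.normSq (z 0) := by
      rw [mul_assoc, mul_left_comm (d : ℝ), mul_le_mul_iff_right₀ hr2]
    simp only [this]
    split_ifs
    · ring
    · simp

lemma truncOverlap_single {d : ℕ} [NeZero d] (z : Fin d → ℂ) :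
    truncOverlap (Pi.single 0 1) z = if sqNorm z ≤ d * Complex.normSq (z 0) then
      Complex.normSq (z 0) / sqNorm z else 0 := by
  have h4 : sqNorm (Pi.single 0 1 : Fin d → ℂ) = 1 := by
    rw [sqNorm, Finset.sum_eq_single 0]
    · simp
    · intro i _ hi; simp [hi]
    · simp
  simp [truncOverlap, h4]

lemma abs_truncOverlap_single_le {d : ℕ} [NeZero d] (z : Fin d → ℂ) :
    |truncOverlap (Pi.single 0 1) z| ≤ 1 := by
  rw [abs_of_nonneg (truncOverlap_nonneg _ _)]
  refine (truncOverlap_le _ _).trans (div_le_one_of_le₀ ?_ (sqNorm_nonneg z))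
  simpa using normSq_le_sqNorm z 0

lemma intervalIntegral_sub_mul_pow {d : ℝ} (hd : 0 < d) (n : ℕ) (hn : d = n + 1) :
    ∫ s in (d⁻¹)..1, (2 * d * s - 1) * (1 - s) ^ n =
      (1 - 1 / d) ^ (n + 1) * (3 * d - 1) / (d * (d + 1)) := by
  -- The linear factor `a s + b` comes from matching coefficients: `(d + 1) a = 2 d` and `d b - a =
  -- -1`. The antiderivative vanishes at `s = 1`, so only the lower endpoint contributes.
  have hder : ∀ s ∈ Set.uIcc d⁻¹ 1, HasDerivAt
      (fun s : ℝ => -(1 - s) ^ (n + 1) * (2 * d / (d + 1) * s + (d - 1) / (d * (d + 1))))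
      ((2 * d * s - 1) * (1 - s) ^ n) s := by
    intro s _
    have h1 : HasDerivAt (fun s : ℝ => 1 - s) (-1) s := by
      simpa using (hasDerivAt_id s).const_sub 1
    have h2 : HasDerivAt (fun s : ℝ => 2 * d / (d + 1) * s + (d - 1) / (d * (d + 1)))
        (2 * d / (d + 1)) s := by
      simpa using ((hasDerivAt_id s).const_mul (2 * d / (d + 1))).add_const
        ((d - 1) / (d * (d + 1)))
    convert! ((h1.pow (n + 1)).neg).mul h2 using 1
    have hd1 : d + 1 ≠ 0 := by positivity
    simp only [Nat.cast_add, Nat.cast_one, Nat.add_sub_cancel, ← hn, Pi.neg_apply, Pi.pow_apply]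
    field_simp
    ring
  rw [intervalIntegral.integral_eq_sub_of_hasDerivAt hder
    (Continuous.intervalIntegrable (by fun_prop) _ _)]
  have hd1 : d + 1 ≠ 0 := by positivity
  rw [inv_eq_one_div]
  simp only [sub_self, ne_eq, Nat.add_eq_zero_iff, one_ne_zero, and_false, not_false_eq_true,
    zero_pow, neg_zero, zero_mul, zero_sub]
  field_simp
  ring

/-- The antiderivative `d s² - s` vanishes at `s = 1/d`, so there is no boundary term. This is the
layer-cake form of the truncated moment. -/
lemma intervalIntegral_indicator_sub {d t : ℝ} (hd : 1 < d) (ht1 : t ≤ 1) :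
    ∫ s in (d⁻¹)..1, (2 * d * s - 1) * (if s ≤ t then 1 else 0) =
      if 1 ≤ d * t then t * (d * t - 1) else 0 := by
  have hd0 : 0 < d := by linarith
  have hle : d⁻¹ ≤ 1 := inv_le_one_of_one_le₀ hd.le
  have hiff : 1 ≤ d * t ↔ d⁻¹ ≤ t := by
    rw [inv_le_iff_one_le_mul₀' hd0]
  simp only [mul_ite, mul_one, mul_zero]
  have hind : (fun s => if s ≤ t then 2 * d * s - 1 else 0) =
      (Set.Iic t).indicator fun s => 2 * d * s - 1 := by
    ext s; simp [Set.indicator]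
  rw [hind, intervalIntegral.integral_of_le hle, setIntegral_indicator measurableSet_Iic,
    Set.Ioc_inter_Iic, min_eq_right ht1]
  split_ifs with h
  · rw [← intervalIntegral.integral_of_le (hiff.1 h), intervalIntegral.integral_eq_sub_of_hasDerivAt
      (f := fun s => d * s ^ 2 - s)]
    · field_simp
      ring
    · intro s _
      convert! ((hasDerivAt_pow 2 s).const_mul d).sub (hasDerivAt_id s) using 1
      simp; ring
    · exact Continuous.intervalIntegrable (by fun_prop) _ _
  · rw [Set.Ioc_eq_empty (fun hlt => h (hiff.2 hlt.le)), setIntegral_empty]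

/-- The moment of the truncated overlap that determines the visibility of the local model. -/
lemma integral_truncOverlap_mul (n : ℕ) (hn : 1 ≤ n) :
    ∫ z, truncOverlap (Pi.single 0 1) z *
      (((n + 1 : ℕ) : ℝ) * (Complex.normSq (z 0) / sqNorm z) - 1) ∂complexGaussian (n + 1) =
      n * (pTilde (n + 1) / ((n + 1 : ℕ) : ℝ)) := by
  set d : ℝ := ((n + 1 : ℕ) : ℝ) with hd
  have hdn : d = n + 1 := by rw [hd]; push_cast; ring
  have hn1 : (1 : ℝ) ≤ n := by exact_mod_cast hn
  have hd1 : 1 < d := by linarith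
  have hd0 : 0 < d := by linarith
  have hle : d⁻¹ ≤ 1 := inv_le_one_of_one_le₀ hd1.le
  -- With `t = |z₀|²/|z|²` the integrand is `t (d t - 1)` on `t ≥ 1/d` and zero elsewhere. Its
  -- layer-cake form leaves, after Fubini, only the tail probabilities of `t`.
  have hae : ∀ᵐ z ∂complexGaussian (n + 1), truncOverlap (Pi.single 0 1) z *
      (d * (Complex.normSq (z 0) / sqNorm z) - 1) = ∫ s in (d⁻¹)..1,
        (2 * d * s - 1) * (if s * sqNorm z ≤ Complex.normSq (z 0) then 1 else 0) := by
    filter_upwards [ae_sqNorm_ne_zero n] with z hz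
    have hz0 : 0 < sqNorm z := (sqNorm_nonneg z).lt_of_ne' hz
    have ht : Complex.normSq (z 0) / sqNorm z ≤ 1 :=
      div_le_one_of_le₀ (normSq_le_sqNorm z 0) hz0.le
    have h := intervalIntegral_indicator_sub hd1 ht
    simp only [le_div_iff₀ hz0] at h
    rw [h, truncOverlap_single]
    have : (1 ≤ d * (Complex.normSq (z 0) / sqNorm z)) ↔
        sqNorm z ≤ d * Complex.normSq (z 0) := by
      rw [← mul_div_assoc, one_le_div hz0]
    simp only [this]
    split_ifs <;> simp
  have hmeas : Measurable fun p : (Fin (n + 1) → ℂ) × ℝ => (2 * d * p.2 - 1) *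
      (if p.2 * sqNorm p.1 ≤ Complex.normSq (p.1 0) then (1 : ℝ) else 0) := by
    have h0 : Measurable fun p : (Fin (n + 1) → ℂ) × ℝ => Complex.normSq (p.1 0) :=
      Complex.continuous_normSq.measurable.comp ((measurable_pi_apply 0).comp measurable_fst)
    refine Measurable.mul (by fun_prop) (Measurable.ite (measurableSet_le (by fun_prop) h0)
      measurable_const measurable_const)
  have hint : Integrable (Function.uncurry fun (z : Fin (n + 1) → ℂ) (s : ℝ) => (2 * d * s - 1) *
      (if s * sqNorm z ≤ Complex.normSq (z 0) then (1 : ℝ) else 0))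
      ((complexGaussian (n + 1)).prod (volume.restrict (Set.Ioc d⁻¹ 1))) := by
    have h1 : Integrable (fun p : (Fin (n + 1) → ℂ) × ℝ => (1 : ℝ) * (2 * d * p.2 - 1))
        ((complexGaussian (n + 1)).prod (volume.restrict (Set.Ioc d⁻¹ 1))) := by
      refine Integrable.mul_prod (f := fun _ : Fin (n + 1) → ℂ => (1 : ℝ))
        (g := fun s : ℝ => 2 * d * s - 1) (integrable_const 1) ?_
      rw [← IntegrableOn, ← intervalIntegrable_iff_integrableOn_Ioc_of_le hle]
      exact Continuous.intervalIntegrable (by fun_prop) _ _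
    refine h1.mono hmeas.aestronglyMeasurable (ae_of_all _ fun p => ?_)
    simp only [Function.uncurry, norm_mul, one_mul]
    refine mul_le_of_le_one_right (norm_nonneg _) ?_
    split_ifs <;> simp
  rw [integral_congr_ae hae]
  simp_rw [intervalIntegral.integral_of_le hle]
  rw [integral_integral_swap hint]
  simp_rw [integral_const_mul]
  -- The tail formula requires `s < 1`; the endpoint is a null set.
  rw [integral_Ioc_eq_integral_Ioo]
  have hin : ∀ s ∈ Set.Ioo d⁻¹ 1, (2 * d * s - 1) * ∫ z : Fin (n + 1) → ℂ,
      (if s * sqNorm z ≤ Complex.normSq (z 0) then (1 : ℝ) else 0) ∂complexGaussian (n + 1) =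
      (2 * d * s - 1) * (1 - s) ^ n := by
    intro s hs
    rw [integral_tail_complexGaussian n ((inv_pos.2 hd0).trans hs.1) hs.2]
  rw [setIntegral_congr_fun measurableSet_Ioo hin, ← integral_Ioc_eq_integral_Ioo,
    ← intervalIntegral.integral_of_le hle, intervalIntegral_sub_mul_pow hd0 n hdn, pTilde, ← hd]
  have h2 : d ^ 2 - 1 = n * (d + 1) := by rw [hdn]; ring
  have hn0 : (n : ℝ) ≠ 0 := by positivity
  rw [h2]
  field_simp

/-- Sign flips and permutations fixing coordinate `0` force the average to be `diag (α + γ, γ, …,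
γ)`. With `d = n + 1`, the moment `E[T (d t - 1)]` is `d` times the first entry minus the trace,
that is `n α`, which determines `α`. -/
lemma stateAverage_truncOverlap_single (n : ℕ) (hn : 1 ≤ n) :
    ∃ γ : ℂ, stateAverage (truncOverlap (Pi.single (0 : Fin (n + 1)) 1)) =
      ((pTilde (n + 1) / ((n + 1 : ℕ) : ℝ) : ℝ) : ℂ) •
        Matrix.vecMulVec (Pi.single 0 1) (star (Pi.single 0 1)) + γ • 1 := by
  set T : (Fin (n + 1) → ℂ) → ℝ := truncOverlap (Pi.single (0 : Fin (n + 1)) 1) with hT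
  have hm : Measurable T := measurable_truncOverlap _
  have hc : ∀ z, |T z| ≤ 1 := abs_truncOverlap_single_le
  have hoff : ∀ {i j}, i ≠ j → stateAverage T i j = 0 := fun hij => by
    refine stateAverage_offDiag hm hc (fun k z => ?_) hij
    have h0 : Complex.normSq ((signFlip k *ᵥ z) 0) = Complex.normSq (z 0) := by
      rw [signFlip_mulVec]; split_ifs <;> simp
    rw [hT, truncOverlap_single, truncOverlap_single, sqNorm_mulVec (signFlip_mem k), h0]
  have hdiag : ∀ i : Fin n, stateAverage T i.succ i.succ = stateAverage T (Fin.last n) (Fin.last n) := by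
    intro i
    refine stateAverage_diag_eq hm hc fun z => ?_
    have hl : (0 : Fin (n + 1)) ≠ Fin.last n := by
      intro h
      have := congrArg Fin.val h
      simp at this
      omega
    have h0 : (z ∘ Equiv.swap i.succ (Fin.last n)) 0 = z 0 := by
      rw [Function.comp_apply, Equiv.swap_apply_of_ne_of_ne (Fin.succ_ne_zero i).symm hl]
    have h1 : sqNorm (z ∘ Equiv.swap i.succ (Fin.last n)) = sqNorm z :=
      Equiv.sum_comp (Equiv.swap i.succ (Fin.last n)) fun j => Complex.normSq (z j)
    rw [hT, truncOverlap_single, truncOverlap_single, h0, h1]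
  set γ := stateAverage T (Fin.last n) (Fin.last n) with hγ
  have htr := trace_stateAverage hm hc
  rw [Fin.sum_univ_succ, Finset.sum_congr rfl fun i _ => hdiag i] at htr
  simp only [Finset.sum_const, Finset.card_univ, Fintype.card_fin, nsmul_eq_mul] at htr
  have h00 : stateAverage T 0 0 = ((∫ z, T z * (Complex.normSq (z 0) / sqNorm z)
      ∂complexGaussian (n + 1) : ℝ) : ℂ) := by
    rw [stateAverage_apply, ← integral_complex_ofReal]
    congr 1 with z
    rw [pureState_apply]
    split_ifs with h
    · have : T z = 0 := by
        rw [hT, truncOverlap_single, h]; simp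
      simp [this]
    · rw [Complex.star_def, Complex.mul_conj]
      push_cast
      field_simp
  have hmt : Measurable fun z : Fin (n + 1) → ℂ => Complex.normSq (z 0) / sqNorm z :=
    (Complex.continuous_normSq.measurable.comp (measurable_pi_apply 0)).div measurable_sqNorm
  have hi1 : Integrable T (complexGaussian (n + 1)) :=
    (integrable_const (1 : ℝ)).mono' hm.aestronglyMeasurable (ae_of_all _ hc)
  have hi2 : Integrable (fun z => T z * (Complex.normSq (z 0) / sqNorm z))
      (complexGaussian (n + 1)) := by
    refine (integrable_const (1 : ℝ)).mono' (hm.mul hmt).aestronglyMeasurable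
      (ae_of_all _ fun z => ?_)
    rw [norm_mul]
    refine mul_le_one₀ (hc z) (norm_nonneg _) ?_
    rw [Real.norm_of_nonneg (div_nonneg (Complex.normSq_nonneg _) (sqNorm_nonneg z))]
    exact div_le_one_of_le₀ (normSq_le_sqNorm z 0) (sqNorm_nonneg z)
  have hmom := integral_truncOverlap_mul n hn
  have hexp : (fun z : Fin (n + 1) → ℂ => T z *
      (((n + 1 : ℕ) : ℝ) * (Complex.normSq (z 0) / sqNorm z) - 1)) =
      fun z => ((n + 1 : ℕ) : ℝ) * (T z * (Complex.normSq (z 0) / sqNorm z)) - T z := by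
    ext z; ring
  rw [← hT, hexp, integral_sub (hi2.const_mul _) hi1, integral_const_mul] at hmom
  have hn0 : (n : ℂ) ≠ 0 := by
    have : n ≠ 0 := by omega
    exact_mod_cast this
  have hkey : stateAverage T 0 0 = ((pTilde (n + 1) / ((n + 1 : ℕ) : ℝ) : ℝ) : ℂ) + γ := by
    have hmomC := congrArg (fun x : ℝ => (x : ℂ)) hmom
    simp only [Complex.ofReal_sub, Complex.ofReal_mul, Complex.ofReal_natCast] at hmomC
    rw [← h00, ← htr] at hmomC
    push_cast at hmomC ⊢
    apply mul_left_cancel₀ hn0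
    linear_combination hmomC
  refine ⟨γ, ?_⟩
  ext i j
  rw [Matrix.add_apply, Matrix.smul_apply, Matrix.smul_apply, Matrix.vecMulVec_apply]
  by_cases hij : i = j
  · subst hij
    refine Fin.cases ?_ (fun k => ?_) i
    · rw [hkey]; simp
    · rw [hdiag k]; simp
  · rw [hoff hij, Matrix.one_apply_ne hij]
    by_cases hi : i = 0
    · subst hi
      simp [Pi.single_eq_of_ne (Ne.symm hij)]
    · simp [Pi.single_eq_of_ne hi]

/-- The average of the pure states weighted by the truncated overlap with `u`. -/
lemma stateAverage_truncOverlap {d : ℕ} (hd : 2 ≤ d) :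
    ∃ γ : ℂ, ∀ u : Fin d → ℂ, stateAverage (truncOverlap u) =
      ((pTilde d / d : ℝ) : ℂ) • Matrix.vecMulVec u (star u) + (γ * sqNorm u) • 1 := by
  obtain ⟨n, rfl⟩ : ∃ n, d = n + 1 := ⟨d - 1, by omega⟩
  obtain ⟨γ, hγ⟩ := stateAverage_truncOverlap_single n (by omega)
  refine ⟨γ, fun u => ?_⟩
  obtain ⟨U, hU, hu⟩ := exists_unitary_col u
  set r := Real.sqrt (sqNorm u) with hr
  have hr2 : r ^ 2 = sqNorm u := Real.sq_sqrt (sqNorm_nonneg u)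
  have hT : ∀ z, truncOverlap u (U *ᵥ z) = r ^ 2 * truncOverlap (Pi.single 0 1) z := fun z => by
    rw [hu]; exact truncOverlap_unitary hU r z
  have hscale : stateAverage (fun z : Fin (n + 1) → ℂ => r ^ 2 * truncOverlap (Pi.single 0 1) z) =
      ((r ^ 2 : ℝ) : ℂ) • stateAverage (truncOverlap (Pi.single (0 : Fin (n + 1)) 1)) := by
    ext i j
    rw [Matrix.smul_apply, stateAverage_apply, stateAverage_apply, smul_eq_mul, ← integral_const_mul]
    congr 1 with z
    push_cast; ring
  rw [stateAverage_unitary hU ((measurable_truncOverlap _).const_mul (r ^ 2)) (c := r ^ 2) ?_ hT,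
    hscale, hγ]
  · have hv : Matrix.vecMulVec u (star u) =
        ((r ^ 2 : ℝ) : ℂ) • (U * Matrix.vecMulVec (Pi.single 0 1) (star (Pi.single 0 1)) * Uᴴ) := by
      rw [Matrix.mul_vecMulVec, Matrix.vecMulVec_mul, ← Matrix.star_mulVec]
      conv_lhs => rw [hu]
      rw [star_smul, Matrix.smul_vecMulVec, Matrix.vecMulVec_smul, smul_smul]
      simp [sq]
    rw [hv, mul_smul_comm, smul_mul_assoc, mul_add, add_mul, mul_smul_comm, smul_mul_assoc,
      mul_smul_comm, smul_mul_assoc, mul_one, ← Matrix.star_eq_conjTranspose,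
      Matrix.mem_unitaryGroup_iff.1 hU, hr2, smul_add, smul_smul, smul_smul, smul_smul]
    congr 2 <;> ring_nf
  · intro z
    rw [abs_mul, abs_of_nonneg (sq_nonneg r)]
    exact mul_le_of_le_one_right (sq_nonneg r) (abs_truncOverlap_single_le z)

/-! ### The local-hidden-state model for isotropic states -/

lemma IsResponse.le_one {X A L : Type*} [Fintype A] [MeasurableSpace L] {p : X → A → L → ℝ}
    (h : IsResponse p) (x : X) (a : A) (l : L) : p x a l ≤ 1 := by
  rw [← h.2.2 x l]
  exact Finset.single_le_sum (f := fun a => p x a l) (fun a _ => h.2.1 x a l) (Finset.mem_univ a)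

lemma IsResponse.abs_le_one {X A L : Type*} [Fintype A] [MeasurableSpace L] {p : X → A → L → ℝ}
    (h : IsResponse p) (x : X) (a : A) (l : L) : |p x a l| ≤ 1 := by
  rw [abs_of_nonneg (h.2.1 x a l)]
  exact h.le_one x a l

/-- The assemblage that the POVMs `E` prepare on the isotropic state of visibility `pTilde d`. -/
def isotropicAssemblage {d : ℕ} {X A : Type*} (E : X → A → Op d) : X → A → Op d :=
  fun x a => ((pTilde d / d : ℝ) : ℂ) • (E x a)ᵀ +
    (((1 - pTilde d) / (d : ℝ) ^ 2 : ℝ) * (E x a).trace) • (1 : Op d)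

lemma trace_vecMulVec_self {d : ℕ} (u : Fin d → ℂ) :
    (Matrix.vecMulVec u (star u)).trace = sqNorm u := by
  rw [Matrix.trace_vecMulVec, dotProduct_comm, sqNorm_eq_dotProduct]

lemma dotProduct_vecMulVec_mulVec {d : ℕ} (u z : Fin d → ℂ) :
    star z ⬝ᵥ (Matrix.vecMulVec u (star u) *ᵥ z) = Complex.normSq (star u ⬝ᵥ z) := by
  have h : star z ⬝ᵥ u = star (star u ⬝ᵥ z) := by
    rw [Matrix.star_dotProduct]
  rw [Matrix.vecMulVec_mulVec, dotProduct_smul, h, Complex.star_def, op_smul_eq_mul,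
    mul_comm, Complex.mul_conj]

/-- The isotropic state of visibility `pTilde d` is unsteerable under general POVMs. -/
theorem isLHS_isotropicAssemblage {d : ℕ} (hd : 2 ≤ d) {X A : Type*} [Fintype A]
    {E : X → A → Op d} (hE : IsPOVMFamily E) : IsLHS (isotropicAssemblage E) := by
  have : NeZero d := ⟨by omega⟩
  have hd0 : (0 : ℝ) < d := by exact_mod_cast (by omega : 0 < d)
  have hdC : (d : ℂ) ≠ 0 := by exact_mod_cast hd0.ne'
  obtain ⟨γ, hγ⟩ := stateAverage_truncOverlap hd
  -- The transpose appears because measuring `E` on `Ψ⁺` steers Bob to `Eᵀ / d`.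
  have hdec : ∀ x a, ∃ (m : ℕ) (v : Fin m → Fin d → ℂ),
      (E x a)ᵀ = ∑ k, Matrix.vecMulVec (v k) (star (v k)) := fun x a =>
    Matrix.posSemidef_iff_eq_sum_vecMulVec.1 (hE.1 x a).transpose
  choose m v hv using hdec
  have hone : ∀ x, ∑ a, ∑ k, Matrix.vecMulVec (v x a k) (star (v x a k)) = 1 := fun x => by
    simp_rw [← hv]
    rw [← Matrix.transpose_sum, hE.2 x, Matrix.transpose_one]
  have htr : ∀ x a, (E x a).trace = ((∑ k, sqNorm (v x a k) : ℝ) : ℂ) := fun x a => by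
    rw [← Matrix.trace_transpose, hv, Matrix.trace_sum, Complex.ofReal_sum]
    exact Finset.sum_congr rfl fun k _ => trace_vecMulVec_self _
  have hsum : ∀ x, ∑ a, ∑ k, sqNorm (v x a k) = d := fun x => by
    have h := congrArg Matrix.trace (hE.2 x)
    simp_rw [Matrix.trace_sum, htr] at h
    rw [Matrix.trace_one, Fintype.card_fin] at h
    exact_mod_cast h
  have hpar : ∀ x z, ∑ a, ∑ k, Complex.normSq (star (v x a k) ⬝ᵥ z) = sqNorm z := fun x z => by
    have h := congrArg (fun M : Op d => star z ⬝ᵥ (M *ᵥ z)) (hone x)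
    simp only [Matrix.sum_mulVec, dotProduct_sum, dotProduct_vecMulVec_mulVec, Matrix.one_mulVec,
      ← sqNorm_eq_dotProduct] at h
    exact_mod_cast h
  -- The total acceptance probability; it is at most one because the untruncated overlaps sum to one
  -- (or to `0 / 0 = 0` at `z = 0`).
  set W : X → (Fin d → ℂ) → ℝ := fun x z => ∑ a, ∑ k, truncOverlap (v x a k) z with hW
  have hW1 : ∀ x z, W x z ≤ 1 := fun x z => by
    calc W x z ≤ ∑ a, ∑ k, Complex.normSq (star (v x a k) ⬝ᵥ z) / sqNorm z :=
          Finset.sum_le_sum fun a _ => Finset.sum_le_sum fun k _ => truncOverlap_le _ _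
      _ = sqNorm z / sqNorm z := by simp_rw [← Finset.sum_div, hpar]
      _ ≤ 1 := div_self_le_one _
  have hTm : ∀ x a k, Measurable (truncOverlap (v x a k)) := fun x a k => measurable_truncOverlap _
  have hT1 : ∀ x a k z, |truncOverlap (v x a k) z| ≤ 1 := fun x a k z => by
    rw [abs_of_nonneg (truncOverlap_nonneg _ _)]
    refine le_trans ?_ (hW1 x z)
    refine (Finset.single_le_sum (f := fun k => truncOverlap (v x a k) z)
      (fun k _ => truncOverlap_nonneg _ _) (Finset.mem_univ k)).trans ?_
    exact Finset.single_le_sum (f := fun a => ∑ k, truncOverlap (v x a k) z)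
      (fun a _ => Finset.sum_nonneg fun k _ => truncOverlap_nonneg _ _) (Finset.mem_univ a)
  -- The rejected weight `1 - W` is shared among the outcomes in proportion to `tr E_a`, which adds
  -- only multiples of the identity.
  set p : X → A → (Fin d → ℂ) → ℝ := fun x a z =>
    ∑ k, truncOverlap (v x a k) z + (∑ k, sqNorm (v x a k)) / d * (1 - W x z) with hp
  have hpr : IsResponse p := by
    refine ⟨fun x a => ?_, fun x a z => ?_, fun x z => ?_⟩
    · exact (Finset.measurable_sum _ fun k _ => hTm x a k).add (measurable_const.mul
        (measurable_const.sub (Finset.measurable_sum _ fun b _ =>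
          Finset.measurable_sum _ fun k _ => hTm x b k)))
    · refine add_nonneg (Finset.sum_nonneg fun k _ => truncOverlap_nonneg _ _) (mul_nonneg
        (div_nonneg (Finset.sum_nonneg fun k _ => sqNorm_nonneg _) hd0.le) ?_)
      linarith [hW1 x z]
    · simp only [hp]
      rw [Finset.sum_add_distrib, ← Finset.sum_mul, ← Finset.sum_div, hsum, div_self hd0.ne']
      simp [hW]
  refine ⟨Fin d → ℂ, inferInstance, complexGaussian d, p, pureState, inferInstance, hpr,
    measurable_pureState, isDensity_pureState, fun x a i j => ?_⟩
  have hI : ∀ a k, Integrable (fun z => (truncOverlap (v x a k) z : ℂ) * pureState z i j)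
      (complexGaussian d) := fun a k => integrable_mul_pureState (hTm x a k) (hT1 x a k) i j
  have hI1 : Integrable (fun z => ((1 : ℝ) : ℂ) * pureState z i j) (complexGaussian d) :=
    integrable_mul_pureState (f := fun _ => 1) measurable_const (c := 1) (by simp) i j
  have hsplit : ∀ z, (p x a z : ℂ) * pureState z i j =
      ∑ k, (truncOverlap (v x a k) z : ℂ) * pureState z i j +
      (((∑ k, sqNorm (v x a k)) / d : ℝ) : ℂ) * (((1 : ℝ) : ℂ) * pureState z i j -
        ∑ b, ∑ k, (truncOverlap (v x b k) z : ℂ) * pureState z i j) := fun z => by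
    simp only [hp, hW, ← Finset.sum_mul]
    push_cast
    ring
  simp_rw [hsplit]
  have hI2 : Integrable (fun z => ∑ b, ∑ k, (truncOverlap (v x b k) z : ℂ) * pureState z i j)
      (complexGaussian d) :=
    integrable_finsetSum _ fun b _ => integrable_finsetSum _ fun k _ => hI b k
  have hI3 : Integrable (fun z => (((∑ k, sqNorm (v x a k)) / d : ℝ) : ℂ) *
      (((1 : ℝ) : ℂ) * pureState z i j -
        ∑ b, ∑ k, (truncOverlap (v x b k) z : ℂ) * pureState z i j)) (complexGaussian d) :=
    (hI1.sub hI2).const_mul _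
  rw [integral_add (integrable_finsetSum _ fun k _ => hI a k) hI3,
    integral_const_mul, integral_sub hI1 hI2,
    integral_finsetSum _ fun k _ => hI a k,
    integral_finsetSum _ fun b _ => integrable_finsetSum _ fun k _ => hI b k]
  simp_rw [integral_finsetSum _ fun k _ => hI _ k]
  simp_rw [← stateAverage_apply]
  rw [stateAverage_one]
  simp_rw [hγ]
  have hval : ∀ b, ∑ k, (((pTilde d / d : ℝ) : ℂ) • Matrix.vecMulVec (v x b k) (star (v x b k)) +
      (γ * sqNorm (v x b k)) • (1 : Op d)) i j =
      ((pTilde d / d : ℝ) : ℂ) * (E x b)ᵀ i j + γ * (E x b).trace * (1 : Op d) i j := fun b => by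
    rw [← Matrix.sum_apply, Finset.sum_add_distrib, ← Finset.smul_sum, ← hv, ← Finset.sum_smul,
      ← Finset.mul_sum, htr, Complex.ofReal_sum]
    simp
  simp_rw [hval]
  -- Summed over outcomes, the accepted part is `(p/d + γ d) 1`. The rejection term is therefore
  -- `(tr E / d) (1/d - p/d - γ d) 1`, and its `γ` cancels the `γ tr E` of the accepted term.
  rw [Finset.sum_add_distrib, ← Finset.mul_sum, ← Finset.sum_mul, ← Finset.mul_sum,
    ← Matrix.sum_apply, ← Matrix.transpose_sum, hE.2, ← Matrix.trace_sum, hE.2, Matrix.transpose_one,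
    Matrix.trace_one, Fintype.card_fin]
  rw [Complex.ofReal_div _ (d : ℝ), Complex.ofReal_div (∑ k, _) (d : ℝ), ← htr,
    isotropicAssemblage]
  simp only [Matrix.add_apply, Matrix.smul_apply, smul_eq_mul, Complex.ofReal_div,
    Complex.ofReal_natCast, Complex.ofReal_sub, Complex.ofReal_one, Complex.ofReal_pow]
  field_simp
  ring

/-! ### The maximally entangled state -/

lemma maxEnt_apply {d : ℕ} (i j k l : Fin d) :
    maxEnt d (i, j) (k, l) = if i = j ∧ k = l then (d : ℂ)⁻¹ else 0 := by
  have h : (Real.sqrt d : ℂ) * Real.sqrt d = d := by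
    rw [← Complex.ofReal_mul, Real.mul_self_sqrt (Nat.cast_nonneg d), Complex.ofReal_natCast]
  simp only [maxEnt, Matrix.vecMulVec_apply, maxEntKet, Pi.star_apply]
  by_cases h1 : i = j <;> by_cases h2 : k = l <;> simp [h1, h2]
  rw [← mul_inv, h]

lemma assemblage_maxEnt {d : ℕ} {X A : Type*} (E : X → A → Op d) (x : X) (a : A) :
    assemblage (maxEnt d) E x a = (d : ℂ)⁻¹ • (E x a)ᵀ := by
  ext j j'
  simp only [assemblage, partialTraceA, Matrix.of_apply, Matrix.mul_apply, Fintype.sum_prod_type,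
    maxEnt_apply, Matrix.kroneckerMap_apply, Matrix.one_apply, Matrix.smul_apply,
    Matrix.transpose_apply, smul_eq_mul, ite_and]
  simp

/-- Identifies Bell correlations with Bob's measurements on the steered assemblage, so that the
steering comparison applies to them. -/
lemma quantumCorrelation_maxEnt {d : ℕ} {A B X Y : Type*} (E : X → A → Op d) (G : Y → B → Op d)
    (a : A) (b : B) (x : X) (y : Y) : quantumCorrelation (maxEnt d) E G a b x y =
      ((G y b * assemblage (maxEnt d) E x a).trace).re := by
  rw [quantumCorrelation, assemblage_maxEnt]
  congr 1
  simp only [Matrix.trace, Matrix.diag_apply, Matrix.mul_apply, Fintype.sum_prod_type,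
    maxEnt_apply, Matrix.kroneckerMap_apply, Matrix.smul_apply,
    Matrix.transpose_apply, smul_eq_mul, ite_and]
  simp
  rw [Finset.sum_comm]
  refine Finset.sum_congr rfl fun i _ => Finset.sum_congr rfl fun j _ => ?_
  ring

/-! ### Traces of products of positive semidefinite matrices -/

lemma trace_mul_vecMulVec {d : ℕ} (u v : Fin d → ℂ) :
    (Matrix.vecMulVec u (star u) * Matrix.vecMulVec v (star v)).trace =
      Complex.normSq (star u ⬝ᵥ v) := by
  rw [Matrix.mul_vecMulVec, Matrix.trace_vecMulVec, dotProduct_comm, dotProduct_vecMulVec_mulVec]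

lemma normSq_dotProduct_le {d : ℕ} (u v : Fin d → ℂ) :
    Complex.normSq (star u ⬝ᵥ v) ≤ sqNorm u * sqNorm v := by
  have h : ‖star u ⬝ᵥ v‖ ≤ ∑ i, ‖u i‖ * ‖v i‖ := by
    refine (norm_sum_le _ _).trans (le_of_eq (Finset.sum_congr rfl fun i _ => ?_))
    rw [norm_mul, Pi.star_apply, norm_star]
  simp only [Complex.normSq_eq_norm_sq, sqNorm]
  exact (pow_le_pow_left₀ (norm_nonneg _) h 2).trans (Finset.sum_mul_sq_le_sq_mul_sq _ _ _)

/-- After splitting both matrices into rank-one pieces, each term is `|⟨u|v⟩|²`, and Cauchy–Schwarz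
gives the upper bound. -/
lemma trace_mul_re_bounds {d : ℕ} {F S : Op d} (hF : F.PosSemidef) (hS : S.PosSemidef) :
    0 ≤ ((F * S).trace).re ∧ ((F * S).trace).re ≤ F.trace.re * S.trace.re := by
  obtain ⟨m, u, rfl⟩ := Matrix.posSemidef_iff_eq_sum_vecMulVec.1 hF
  obtain ⟨n, v, rfl⟩ := Matrix.posSemidef_iff_eq_sum_vecMulVec.1 hS
  simp only [Finset.sum_mul, Finset.mul_sum, Matrix.trace_sum, trace_mul_vecMulVec,
    trace_vecMulVec_self, Complex.re_sum, Complex.ofReal_re]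
  exact ⟨Finset.sum_nonneg fun _ _ => Finset.sum_nonneg fun _ _ => Complex.normSq_nonneg _,
    Finset.sum_le_sum fun _ _ => Finset.sum_le_sum fun _ _ => normSq_dotProduct_le _ _⟩

/-! ### The visibility -/

lemma pTilde_pos {d : ℕ} (hd : 2 ≤ d) : 0 < pTilde d := by
  have h : (2 : ℝ) ≤ d := by exact_mod_cast hd
  have h1 : 1 / (d : ℝ) < 1 := by rw [div_lt_one] <;> linarith
  unfold pTilde
  refine mul_pos (div_pos (by linarith) (by nlinarith)) (pow_pos (by linarith) _)

lemma pTilde_le_one {d : ℕ} (hd : 2 ≤ d) : pTilde d ≤ 1 := by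
  have h : (2 : ℝ) ≤ d := by exact_mod_cast hd
  have h1 : 1 / (d : ℝ) ≤ 1 := by rw [div_le_one] <;> linarith
  have h0 : 0 ≤ 1 - 1 / (d : ℝ) := by linarith
  have hpow : (1 - 1 / (d : ℝ)) ^ d ≤ (1 - 1 / (d : ℝ)) ^ 2 :=
    pow_le_pow_of_le_one h0 (by linarith [show 0 ≤ 1 / (d : ℝ) by positivity]) hd
  have hq : 0 ≤ (3 * (d : ℝ) - 1) / ((d : ℝ) ^ 2 - 1) := div_nonneg (by linarith) (by nlinarith)
  refine (mul_le_mul_of_nonneg_left hpow hq).trans ?_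
  have hd1 : (0 : ℝ) < d ^ 2 - 1 := by nlinarith
  have hdp : (0 : ℝ) < d := by linarith
  have he : (1 - 1 / (d : ℝ)) ^ 2 = (d - 1) ^ 2 / d ^ 2 := by field_simp
  rw [he, div_mul_div_comm, div_le_one (by positivity)]
  nlinarith [mul_nonneg (sub_nonneg.2 h) (sub_nonneg.2 h), pow_pos hdp 3]

lemma violationBound_pos {d : ℕ} (hd : 2 ≤ d) : 0 < violationBound d := by
  have h : (2 : ℝ) ≤ d := by exact_mod_cast hd
  have := pTilde_pos hd
  unfold violationBound
  have : (0 : ℝ) < d ^ 2 - 1 := by nlinarith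
  positivity

/-- Replacing the maximally entangled state by the isotropic one costs at most `violationBound`. -/
lemma steeringValue_maxEnt_le {d : ℕ} (hd : 2 ≤ d) {X A : Type*} [Fintype X] [Fintype A]
    {F E : X → A → Op d} (hF : ∀ x a, (F x a).PosSemidef) (hE : IsPOVMFamily E) :
    steeringValue F (assemblage (maxEnt d) E) ≤
      violationBound d * steeringValue F (isotropicAssemblage E) := by
  have h : (2 : ℝ) ≤ d := by exact_mod_cast hd
  have hp := pTilde_pos hd
  have hp1 := pTilde_le_one hd
  have hd1 : (0 : ℝ) < d ^ 2 - 1 := by nlinarith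
  have hdp : (0 : ℝ) < d := by linarith
  have hN : 0 < ((d : ℝ) ^ 2 - 1) * pTilde d + 1 := by positivity
  unfold steeringValue
  simp_rw [Finset.mul_sum]
  refine Finset.sum_le_sum fun x _ => Finset.sum_le_sum fun a _ => ?_
  obtain ⟨h0, hle⟩ := trace_mul_re_bounds (hF x a) (hE.1 x a).transpose
  rw [Matrix.trace_transpose] at hle
  have hFi : (F x a).trace.im = 0 := (Complex.nonneg_iff.1 (hF x a).trace_nonneg).2.symm
  have hiso : ((F x a * isotropicAssemblage E x a).trace).re =
      pTilde d / d * ((F x a * (E x a)ᵀ).trace).re +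
      (1 - pTilde d) / (d : ℝ) ^ 2 * ((F x a).trace.re * (E x a).trace.re) := by
    rw [isotropicAssemblage, mul_add, mul_smul_comm, mul_smul_comm, mul_one, Matrix.trace_add,
      Matrix.trace_smul, Matrix.trace_smul, smul_eq_mul, smul_eq_mul, Complex.add_re,
      Complex.re_ofReal_mul, mul_assoc, Complex.re_ofReal_mul, Complex.mul_re, hFi]
    ring
  rw [hiso, assemblage_maxEnt, mul_smul_comm, Matrix.trace_smul, smul_eq_mul,
    ← Complex.ofReal_natCast, ← Complex.ofReal_inv, Complex.re_ofReal_mul]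
  set τ := ((F x a * (E x a)ᵀ).trace).re
  set ξ := (F x a).trace.re * (E x a).trace.re
  -- The bound `τ ≤ ξ` is weakened on purpose: `τ / d ≤ ξ` already yields the factor `p + (1 - p)/d²
  -- = 1 / violationBound d`.
  have hτ : τ / d ≤ ξ := (div_le_self h0 (by linarith)).trans hle
  rw [violationBound, div_mul_eq_mul_div, le_div_iff₀ hN]
  have e1 : (d : ℝ) ^ 2 * (pTilde d / d * τ + (1 - pTilde d) / (d : ℝ) ^ 2 * ξ) =
      d ^ 2 * pTilde d * (τ / d) + (1 - pTilde d) * ξ := by field_simp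
  rw [e1, inv_mul_eq_div]
  nlinarith [mul_le_mul_of_nonneg_left hτ (sub_nonneg.2 hp1)]

/-! ### Steering and Bell bounds -/

lemma bddAbove_lhsValues {d : ℕ} {X A : Type*} [Fintype X] [Fintype A] (F : X → A → Op d) :
    BddAbove (lhsValues F) := by
  refine ⟨∑ x, ∑ a, ∑ i, ∑ j, ‖F x a i j‖, ?_⟩
  rintro _ ⟨σ, ⟨L, _, μ, p, s, _, hp, -, hs, hσ⟩, rfl⟩
  refine Finset.sum_le_sum fun x _ => Finset.sum_le_sum fun a _ => ?_
  have hbound : ∀ i j, ‖σ x a i j‖ ≤ 1 := fun i j => by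
    rw [hσ]
    refine (norm_integral_le_of_norm_le_const (C := 1) (ae_of_all _ fun l => ?_)).trans (by simp)
    rw [norm_mul, Complex.norm_real]
    exact mul_le_one₀ (hp.abs_le_one x a l) (norm_nonneg _) ((hs l).norm_apply_le i j)
  refine (Complex.re_le_norm _).trans ((norm_sum_le _ _).trans (Finset.sum_le_sum fun i _ => ?_))
  rw [Matrix.diag_apply, Matrix.mul_apply]
  refine (norm_sum_le _ _).trans (Finset.sum_le_sum fun j _ => ?_)
  rw [norm_mul]
  exact mul_le_of_le_one_right (norm_nonneg _) (hbound j i)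

lemma isResponse_const {X A L : Type*} [Fintype A] [DecidableEq A] [MeasurableSpace L] (a₀ : A) :
    IsResponse (fun (_ : X) a (_ : L) => if a = a₀ then (1 : ℝ) else 0) := by
  refine ⟨fun _ _ => measurable_const, fun _ a _ => ?_, fun _ _ => by simp⟩
  dsimp only
  split_ifs <;> simp

/-- The witness always answers `a₀` and sends the maximally mixed state. Its value is a sum of
traces `tr F / d`, positive since a positive semidefinite matrix of trace zero vanishes. -/
lemma steeringBound_pos {d : ℕ} (hd : 2 ≤ d) {X A : Type*} [Fintype X] [Fintype A]
    {F : X → A → Op d} (hF : ∀ x a, (F x a).PosSemidef) (hne : ∃ x a, F x a ≠ 0) :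
    0 < steeringBound F := by
  classical
  have : NeZero d := ⟨by omega⟩
  obtain ⟨x₀, a₀, h0⟩ := hne
  have hρ : IsDensity ((d : ℂ)⁻¹ • (1 : Op d)) := by
    simpa [pureState, sqNorm_eq_zero.2] using isDensity_pureState (0 : Fin d → ℂ)
  have hmem : steeringValue F (fun _ a => if a = a₀ then (d : ℂ)⁻¹ • (1 : Op d) else 0) ∈
      lhsValues F := by
    refine ⟨_, ⟨Unit, inferInstance, Measure.dirac (), _, fun _ => (d : ℂ)⁻¹ • (1 : Op d),
      inferInstance, isResponse_const a₀, fun _ _ => measurable_const, fun _ => hρ,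
      fun x a i j => ?_⟩, rfl⟩
    by_cases h : a = a₀ <;> simp [h]
  refine lt_of_lt_of_le ?_ (le_csSup (bddAbove_lhsValues F) hmem)
  have hval : ∀ x a, ((F x a * if a = a₀ then (d : ℂ)⁻¹ • (1 : Op d) else 0).trace).re =
      if a = a₀ then (d : ℝ)⁻¹ * (F x a).trace.re else 0 := fun x a => by
    split_ifs
    · rw [mul_smul_comm, mul_one, Matrix.trace_smul, smul_eq_mul, ← Complex.ofReal_natCast,
        ← Complex.ofReal_inv, Complex.re_ofReal_mul]
    · simp
  unfold steeringValue
  simp_rw [hval]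
  simp only [Finset.sum_ite_eq', Finset.mem_univ, if_true]
  have hdp : (0 : ℝ) < (d : ℝ)⁻¹ := by
    have : 0 < d := by omega
    positivity
  have hnn : ∀ x, 0 ≤ (F x a₀).trace.re := fun x =>
    (Complex.nonneg_iff.1 (hF x a₀).trace_nonneg).1
  refine Finset.sum_pos' (fun x _ => mul_nonneg hdp.le (hnn x)) ⟨x₀, Finset.mem_univ _, ?_⟩
  refine mul_pos hdp ((hnn x₀).lt_of_ne fun h => h0 ?_)
  rw [← (hF x₀ a₀).trace_eq_zero_iff]
  exact Complex.ext h.symm (Complex.nonneg_iff.1 (hF x₀ a₀).trace_nonneg).2.symm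

lemma steeringFraction_le {d : ℕ} (hd : 2 ≤ d) {X A : Type*} [Fintype X] [Fintype A]
    {F E : X → A → Op d} (hF : ∀ x a, (F x a).PosSemidef) (hne : ∃ x a, F x a ≠ 0)
    (hE : IsPOVMFamily E) :
    steeringFraction (assemblage (maxEnt d) E) F ≤ violationBound d := by
  have hpos := steeringBound_pos hd hF hne
  rw [steeringFraction, one_div_mul_eq_div, div_le_iff₀ hpos]
  exact (steeringValue_maxEnt_le hd hF hE).trans (mul_le_mul_of_nonneg_left
    (le_csSup (bddAbove_lhsValues F) ⟨_, isLHS_isotropicAssemblage hd hE, rfl⟩)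
    (violationBound_pos hd).le)

lemma bddAbove_lhvValues {A B X Y : Type*} [Fintype A] [Fintype B] [Fintype X] [Fintype Y]
    (C : A → B → X → Y → ℝ) : BddAbove (lhvValues C) := by
  refine ⟨∑ a, ∑ b, ∑ x, ∑ y, |C a b x y|, ?_⟩
  rintro _ ⟨P, ⟨L, _, μ, p, q, _, hp, hq, hP⟩, rfl⟩
  refine Finset.sum_le_sum fun a _ => Finset.sum_le_sum fun b _ => Finset.sum_le_sum fun x _ =>
    Finset.sum_le_sum fun y _ => ?_
  refine (le_abs_self _).trans ?_
  rw [abs_mul, hP]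
  refine mul_le_of_le_one_right (abs_nonneg _) ?_
  rw [← Real.norm_eq_abs]
  refine (norm_integral_le_of_norm_le_const (C := 1) (ae_of_all _ fun l => ?_)).trans (by simp)
  rw [norm_mul]
  exact mul_le_one₀ (hp.abs_le_one x a l) (norm_nonneg _) (hq.abs_le_one y b l)

lemma localBound_pos {A B X Y : Type*} [Fintype A] [Fintype B] [Fintype X] [Fintype Y]
    {C : A → B → X → Y → ℝ} (hC : ∀ a b x y, 0 ≤ C a b x y) (hne : ∃ a b x y, C a b x y ≠ 0) :
    0 < localBound C := by
  classical
  obtain ⟨a₀, b₀, x₀, y₀, h0⟩ := hne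
  have hmem : bellValue C (fun a b _ _ => (if a = a₀ then 1 else 0) * if b = b₀ then 1 else 0) ∈
      lhvValues C := by
    refine ⟨_, ⟨Unit, inferInstance, Measure.dirac (), _, _, inferInstance,
      isResponse_const a₀, isResponse_const b₀, fun a b x y => ?_⟩, rfl⟩
    simp
  refine lt_of_lt_of_le ?_ (le_csSup (bddAbove_lhvValues C) hmem)
  have hnn : ∀ a b x y, 0 ≤ C a b x y * ((if a = a₀ then 1 else 0) * if b = b₀ then 1 else 0) :=
    fun a b x y => mul_nonneg (hC a b x y) (by split_ifs <;> simp)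
  refine Finset.sum_pos' (fun a _ => Finset.sum_nonneg fun b _ => Finset.sum_nonneg fun x _ =>
    Finset.sum_nonneg fun y _ => hnn a b x y) ⟨a₀, Finset.mem_univ _, ?_⟩
  refine Finset.sum_pos' (fun b _ => Finset.sum_nonneg fun x _ =>
    Finset.sum_nonneg fun y _ => hnn _ b x y) ⟨b₀, Finset.mem_univ _, ?_⟩
  refine Finset.sum_pos' (fun x _ => Finset.sum_nonneg fun y _ => hnn _ _ x y)
    ⟨x₀, Finset.mem_univ _, ?_⟩
  refine Finset.sum_pos' (fun y _ => hnn _ _ _ y) ⟨y₀, Finset.mem_univ _, ?_⟩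
  simpa using (hC a₀ b₀ x₀ y₀).lt_of_ne h0.symm

/-- Measuring Bob's part of an unsteerable assemblage yields Bell-local correlations. -/
lemma IsLHS.isLHV {d : ℕ} {A B X Y : Type*} [Fintype A] [Fintype B] {σ : X → A → Op d}
    (hσ : IsLHS σ) {G : Y → B → Op d} (hG : IsPOVMFamily G) :
    IsLHV fun a b x y => ((G y b * σ x a).trace).re := by
  obtain ⟨L, _, μ, p, s, _, hp, hsm, hs, hσ⟩ := hσ
  refine ⟨L, inferInstance, μ, p, fun y b l => ((G y b * s l).trace).re, inferInstance, hp,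
    ⟨fun y b => ?_, fun y b l => (trace_mul_re_bounds (hG.1 y b) (hs l).1).1, fun y l => ?_⟩,
    fun a b x y => ?_⟩
  · refine Complex.measurable_re.comp ?_
    simp only [Matrix.trace, Matrix.diag_apply, Matrix.mul_apply]
    exact Finset.measurable_sum _ fun i _ => Finset.measurable_sum _ fun j _ =>
      measurable_const.mul (hsm j i)
  · rw [← Complex.re_sum, ← Matrix.trace_sum, ← Finset.sum_mul, hG.2, one_mul, (hs l).2,
      Complex.one_re]
  · have hI : ∀ i j, Integrable (fun l => G y b i j * ((p x a l : ℂ) * s l j i)) μ := fun i j =>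
      (integrable_mul_density (hp.1 x a) (hp.abs_le_one x a) hsm hs j i).const_mul _
    have hre : ∀ l, p x a l * ((G y b * s l).trace).re =
        RCLike.re (∑ i, ∑ j, G y b i j * ((p x a l : ℂ) * s l j i)) := fun l => by
      rw [← Complex.re_ofReal_mul]
      simp only [Matrix.trace, Matrix.diag_apply, Matrix.mul_apply, Finset.mul_sum]
      refine congrArg Complex.re (Finset.sum_congr rfl fun i _ => Finset.sum_congr rfl fun j _ => ?_)
      ring
    simp_rw [hre]
    rw [integral_re (integrable_finsetSum _ fun i _ => integrable_finsetSum _ fun j _ => hI i j),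
      integral_finsetSum _ fun i _ => integrable_finsetSum _ fun j _ => hI i j]
    simp_rw [integral_finsetSum _ fun j _ => hI _ j, integral_const_mul, ← hσ]
    rfl

/-- Absorbing Bob's effects into the coefficients makes a Bell functional a steering functional,
positive semidefinite when `C ≥ 0`. -/
lemma bellValue_eq_steeringValue {d : ℕ} {A B X Y : Type*}
    [Fintype A] [Fintype B] [Fintype X] [Fintype Y] (C : A → B → X → Y → ℝ) (G : Y → B → Op d)
    (σ : X → A → Op d) : bellValue C (fun a b x y => ((G y b * σ x a).trace).re) =
      steeringValue (fun x a => ∑ b, ∑ y, (C a b x y : ℂ) • G y b) σ := by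
  simp only [bellValue, steeringValue, Finset.sum_mul, Matrix.trace_sum, Complex.re_sum,
    smul_mul_assoc, Matrix.trace_smul, smul_eq_mul, Complex.re_ofReal_mul]
  conv_rhs => rw [Finset.sum_comm]
  refine Finset.sum_congr rfl fun a _ => ?_
  rw [Finset.sum_comm]

lemma nonlocalityFraction_le {d : ℕ} (hd : 2 ≤ d) {A B X Y : Type*}
    [Fintype A] [Fintype B] [Fintype X] [Fintype Y] {C : A → B → X → Y → ℝ}
    (hC : ∀ a b x y, 0 ≤ C a b x y) (hne : ∃ a b x y, C a b x y ≠ 0)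
    {E : X → A → Op d} {G : Y → B → Op d} (hE : IsPOVMFamily E) (hG : IsPOVMFamily G) :
    nonlocalityFraction (quantumCorrelation (maxEnt d) E G) C ≤ violationBound d := by
  have hpos := localBound_pos hC hne
  have hF : ∀ x a, (∑ b, ∑ y, (C a b x y : ℂ) • G y b).PosSemidef := fun x a =>
    Matrix.posSemidef_sum _ fun b _ => Matrix.posSemidef_sum _ fun y _ =>
      (hG.1 y b).smul (by exact_mod_cast hC a b x y)
  have hq : quantumCorrelation (maxEnt d) E G = fun a b x y =>
      ((G y b * assemblage (maxEnt d) E x a).trace).re := by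
    ext a b x y
    exact quantumCorrelation_maxEnt E G a b x y
  rw [nonlocalityFraction, one_div_mul_eq_div, div_le_iff₀ hpos, hq, bellValue_eq_steeringValue]
  refine (steeringValue_maxEnt_le hd hF hE).trans (mul_le_mul_of_nonneg_left ?_
    (violationBound_pos hd).le)
  rw [← bellValue_eq_steeringValue]
  exact le_csSup (bddAbove_lhvValues C) ⟨_, (isLHS_isotropicAssemblage hd hE).isLHV hG, rfl⟩

/-! ### Scaling -/

/-- The factor `d² - 1` cancels, leaving `d² / ((3 d - 1)(1 - 1/d)^d + 1)`, and `(1 - 1/d)^d → 1/e`.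
-/
lemma violationBound_isEquivalent :
    (fun d : ℕ => violationBound d) ~[atTop] (fun d : ℕ => Real.exp 1 * (d : ℝ) / 3) := by
  rw [isEquivalent_iff_tendsto_one]
  · have h1 : Tendsto (fun d : ℕ => (1 - 1 / (d : ℝ)) ^ d) atTop (𝓝 (Real.exp (-1))) := by
      simpa [sub_eq_add_neg, neg_div] using Real.tendsto_one_add_div_pow_exp (-1)
    have h2 : Tendsto (fun d : ℕ => 1 / (d : ℝ)) atTop (𝓝 0) := tendsto_one_div_atTop_nhds_zero_nat
    have h3 : Tendsto (fun d : ℕ => 3 / (Real.exp 1 * ((3 - 1 / (d : ℝ)) * (1 - 1 / (d : ℝ)) ^ d +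
        1 / (d : ℝ)))) atTop (𝓝 (3 / (Real.exp 1 * ((3 - 0) * Real.exp (-1) + 0)))) := by
      refine tendsto_const_nhds.div (tendsto_const_nhds.mul
        (((tendsto_const_nhds.sub h2).mul h1).add h2)) ?_
      positivity
    have h4 : 3 / (Real.exp 1 * ((3 - 0) * Real.exp (-1) + 0)) = 1 := by
      rw [Real.exp_neg]
      field_simp
      norm_num
    rw [h4] at h3
    refine h3.congr' ?_
    filter_upwards [eventually_ge_atTop 2] with d hd
    have h : (2 : ℝ) ≤ d := by exact_mod_cast hd
    have hd1 : (d : ℝ) ^ 2 - 1 ≠ 0 := by nlinarith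
    have hdp : (0 : ℝ) < d := by linarith
    have hq : 0 ≤ 1 - 1 / (d : ℝ) := by
      have : 1 / (d : ℝ) ≤ 1 := by rw [div_le_one] <;> linarith
      linarith
    have hr : 0 ≤ (1 - 1 / (d : ℝ)) ^ d := pow_nonneg hq d
    simp only [Pi.div_apply, violationBound, pTilde]
    set r := (1 - 1 / (d : ℝ)) ^ d
    have e1 : ((d : ℝ) ^ 2 - 1) * ((3 * (d : ℝ) - 1) / ((d : ℝ) ^ 2 - 1) * r) + 1 =
        (3 * d - 1) * r + 1 := by field_simp
    have e2 : (3 - 1 / (d : ℝ)) * r + 1 / d = ((3 * d - 1) * r + 1) / d := by field_simp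
    have hN : (3 * (d : ℝ) - 1) * r + 1 ≠ 0 := by
      have : 0 ≤ (3 * (d : ℝ) - 1) * r := mul_nonneg (by linarith) hr
      linarith
    rw [e1, e2]
    field_simp
  · filter_upwards [eventually_gt_atTop 0] with d hd
    have : (0 : ℝ) < d := by exact_mod_cast hd
    positivity

end QSteering

end

theorem mainTheorem5 :
    (∀ (d : ℕ), 2 ≤ d → ∀ (X A : Type*) [Fintype X] [Fintype A]
      (F : X → A → QSteering.Op d),
      (∀ x a, (F x a).PosSemidef) → (∃ x a, F x a ≠ 0) →
      BddAbove (QSteering.lhsValues F) ∧ 0 < QSteering.steeringBound F ∧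
      BddAbove (QSteering.steeringFractions (QSteering.maxEnt d) F) ∧
      QSteering.LVs (QSteering.maxEnt d) F ≤ QSteering.violationBound d) ∧
    (∀ (d : ℕ), 2 ≤ d → ∀ (A B X Y : Type*) [Fintype A] [Fintype B] [Fintype X] [Fintype Y]
      (C : A → B → X → Y → ℝ),
      (∀ a b x y, 0 ≤ C a b x y) → (∃ a b x y, C a b x y ≠ 0) →
      BddAbove (QSteering.lhvValues C) ∧ 0 < QSteering.localBound C ∧
      BddAbove (QSteering.nonlocalityFractions (QSteering.maxEnt d) C) ∧
      QSteering.LV (QSteering.maxEnt d) C ≤ QSteering.violationBound d) ∧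
    (fun d : ℕ => QSteering.violationBound d) ~[atTop]
      (fun d : ℕ => Real.exp 1 * (d : ℝ) / 3) := by
  refine ⟨fun d hd X A _ _ F hF hne => ?_, fun d hd A B X Y _ _ _ _ C hC hne => ?_,
    QSteering.violationBound_isEquivalent⟩
  · have hle : ∀ v ∈ QSteering.steeringFractions (QSteering.maxEnt d) F,
        v ≤ QSteering.violationBound d := by
      rintro _ ⟨E, hE, rfl⟩
      exact QSteering.steeringFraction_le hd hF hne hE
    -- `Real.sSup_le` asks for a nonnegative bound because `sSup ∅ = 0`; hence no POVM family has to
    -- be exhibited.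
    exact ⟨QSteering.bddAbove_lhsValues F, QSteering.steeringBound_pos hd hF hne, ⟨_, hle⟩,
      Real.sSup_le hle (QSteering.violationBound_pos hd).le⟩
  · have hle : ∀ v ∈ QSteering.nonlocalityFractions (QSteering.maxEnt d) C,
        v ≤ QSteering.violationBound d := by
      rintro _ ⟨E, G, hE, hG, rfl⟩
      exact QSteering.nonlocalityFraction_le hd hC hne hE hG
    exact ⟨QSteering.bddAbove_lhvValues C, QSteering.localBound_pos hC hne, ⟨_, hle⟩,
      Real.sSup_le hle (QSteering.violationBound_pos hd).le⟩
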